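/- **Theorem ($L^p$-almost-periodicity relative to Bohr-compatible measures).** Conventions. Let $G$ be a finite abelian group with dual group $\widehat G$. For $\Gamma\subset\widehat G$ and $\rho\ge 0$, the Bohr set $B=\mathrm{Bohr}(\Gamma,\rho)=\{x\in G: |\gamma(x)-1|\le\rho \text{ for all }\gamma\in\Gamma\}$ (carrying the data $\Gamma,\rho$) has rank $d=|\Gamma|$ and radius $\rho$; $B_\tau=\mathrm{Bohr}(\Gamma,\tau\rho)$. It is regular if $1-12d|\tau|\le |B_{1+\tau}|/|B|\le 1+12d|\tau|$ whenever $12d|\tau|\le 1$. We write $\mathrm{Bohr}(\Lambda,\rho')\le\mathrm{Bohr}(\Gamma,\rho)$ if $\Lambda\supset\Gamma$ and $\rho'\le\rho$. For a positive integer $r$, $rB=B+\dots+B$ is the $r$-fold sumset. A pair $(\nu,\mu)$ of measures on $G$ is $X$-invariant if $\nu(t+Y)\le\mu(Y)$ for all $t\in X$ and $Y\subset G$. Write $\mu_X=1_X/|X|$ (also $\mu_B(S)=|S|/|B|$ for $S\subset B$), $u*v(x)=\sum_y u(y)v(x-y)$, $\|u\|_{L^p(\mu)}^p=\sum_x\mu(x)|u(x)|^p$,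 and $\|\nu\|_{\ell^1}=\nu(G)$. Statement. There are absolute constants $C_1,C_2>0$ such that the following holds. Let $m\ge 1$ be real and $\epsilon,\delta\in(0,1)$. Let $A,L$ be non-empty subsets of a finite abelian group $G$ with $\eta:=|A|/|L|\le 1$, let $B\subset G$ be a regular Bohr set of rank $d\ge 1$ and radius $\rho\in[0,2]$, and let $(\nu,\mu)$ be an $rB$-invariant pair of measures on $G$, where $r\in\mathbb N$ satisfies $r\ge C_1\log(2/\delta\eta)$. Suppose $|A+S|\le K|A|$ for a non-empty subset $S\subset B$, and put $f=\mu_A*1_L\cdot(1-\mu_A*1_L)$. Then there are a positive integer $d'$ with \[ d'\le C_2\left(m\epsilon^{-2}\log^2(2/\delta\eta)\log(2K)+\log(1/\mu_B(S))\right) \] and a regular Bohr set $B'\le B$ of rank at most $d+d'$ and radius at least $\rho\,\delta\,\eta^{1/2}/(d^2d')$ such that, for each $t\in B'$, \[ \|\mu_A*1_L(\cdot+t)-\mu_A*1_L\|_{L^{2m}(\nu)}\le\epsilon\|f\|_{L^m(\mu)}^{1/2}+\epsilon^{2-1/m}\|f\|_{L^1(\mu)}^{1/(2m)}+\delta\|\nu\|_{\ell^1}^{1/(2m)}.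 \] -/

import Mathlib

open scoped Pointwise

/-- The Bohr set `{x | |γ(x) - 1| ≤ ρ for all γ ∈ Γ}` of a set `Γ` of characters, as a set. -/
def bohr {G : Type*} [AddCommGroup G] (Γ : Finset (AddChar G ℂ)) (ρ : ℝ) : Set G :=
  {x | ∀ γ ∈ Γ, ‖γ x - 1‖ ≤ ρ}

/-- A Bohr set together with its defining data: the frequencies and the radius. -/
structure BohrSet (G : Type*) [AddCommGroup G] where
  freqs : Finset (AddChar G ℂ)
  radius : ℝ
  radius_nonneg : 0 ≤ radius

namespace BohrSet

/-- The underlying set of a Bohr set. -/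
def carrier {G : Type*} [AddCommGroup G] (B : BohrSet G) : Set G :=
  bohr B.freqs B.radius

/-- The rank: the number of frequencies. -/
def rank {G : Type*} [AddCommGroup G] (B : BohrSet G) : ℕ :=
  B.freqs.card

/-- The underlying set of the dilate `B_τ`. -/
def dilate {G : Type*} [AddCommGroup G] (B : BohrSet G) (τ : ℝ) : Set G :=
  bohr B.freqs (τ * B.radius)

/-- `B'.IsSub B` : `B'` is a sub-Bohr set of `B`, written `B' ≤ B`. -/
def IsSub {G : Type*} [AddCommGroup G] (B' B : BohrSet G) : Prop :=
  B.freqs ⊆ B'.freqs ∧ B'.radius ≤ B.radius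

/-- Regularity, with `d = rank B`:
`1 - 12 d |τ| ≤ |B_{1+τ}| / |B| ≤ 1 + 12 d |τ|` whenever `12 d |τ| ≤ 1`. -/
def IsRegular {G : Type*} [AddCommGroup G] (B : BohrSet G) : Prop :=
  ∀ τ : ℝ, 12 * (B.rank : ℝ) * |τ| ≤ 1 →
    1 - 12 * (B.rank : ℝ) * |τ| ≤ ((B.dilate (1 + τ)).ncard : ℝ) / (B.carrier.ncard : ℝ) ∧
    ((B.dilate (1 + τ)).ncard : ℝ) / (B.carrier.ncard : ℝ) ≤ 1 + 12 * (B.rank : ℝ) * |τ|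

end BohrSet

/-- The `r`-fold iterated sumset `rX = X + ⋯ + X`. -/
def iteratedSumset {G : Type*} [AddCommGroup G] (r : ℕ) (X : Set G) : Set G :=
  {t | ∃ s : Fin r → G, (∀ i, s i ∈ X) ∧ t = ∑ i, s i}

/-- The pair `(ν, μ)` is `S`-invariant: `τ_t ν ≤ μ` for all `t ∈ S`,
where `τ_t ν (X) = ν (t + X)`. -/
def IsInvariantPair {G : Type*} [AddCommGroup G] [MeasurableSpace G] (S : Set G)
    (ν μ : MeasureTheory.Measure G) : Prop :=
  ∀ t ∈ S, ∀ X : Set G, MeasurableSet X → ν ((fun x => t + x) '' X) ≤ μ X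

/-- The indicator function `1_X`. -/
def ind {G : Type*} [DecidableEq G] (X : Finset G) (x : G) : ℝ :=
  if x ∈ X then 1 else 0

/-- The uniform probability weight `μ_X = 1_X / |X|`. -/
noncomputable def unif {G : Type*} [DecidableEq G] (X : Finset G) (x : G) : ℝ :=
  ind X x / (X.card : ℝ)

/-- The convolution `f * g (x) = ∑ y, f(y) g(x - y)`. -/
def conv {G : Type*} [AddCommGroup G] [Fintype G] (f g : G → ℝ) (x : G) : ℝ :=
  ∑ y, f y * g (x - y)

/-!
Write `g = μ_A * 1_L`. Sampling `A` (Croot–Sisask), with a moment bound of Rosenthal type for the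
sampling error, gives a large `T ⊆ S` and a function `h` such that `h (· + t)` is close to `g` in
`L^{2m}` for every `t ∈ T`. Hence averaging `g` over the translates by `T - t₀` changes it little,
and since each translation in play lies in a sumset of `B`, the invariance of `(ν, μ)` lets the
averaging be iterated `k ≈ log (2 / δη)` times. The Fourier transform of the resulting function is
bounded by `|ft μ_T|^k |ft g|`, where `∑ |ft g| ≤ |G| η^{-1/2}`: the characters at which `|ft μ_T|
≤ 1/2` contribute at most `δ` in sup norm, so only translations that nearly annihilate the large
spectrum of `T` matter. By Chang's theorem relative to Bohr sets these contain a sub-Bohr set of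
`B` with few new frequencies. To prove it, compare `μ_T` with a weight `β ≥ μ_B / 2`, an iterated
average over narrow Bohr sets, whose large spectrum is nearly trivial on a narrow dilate of `B`; a
Riesz product then bounds the size of any set of characters in the large spectrum of `T` that is
dissociated modulo the large spectrum of `β`.
-/

section Fourier

variable {G : Type*} [AddCommGroup G] [Fintype G]

/-- The Fourier transform of a real function on a finite abelian group, unnormalised and with the
character itself, rather than its conjugate, as kernel. -/
noncomputable def ft (u : G → ℝ) (γ : AddChar G ℂ) : ℂ := ∑ x, (u x : ℂ) * γ x

lemma ft_conv (u w : G → ℝ) (γ : AddChar G ℂ) : ft (conv u w) γ = ft u γ * ft w γ := by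
  simp only [ft, conv, Complex.ofReal_sum, Complex.ofReal_mul, Finset.sum_mul]
  rw [Finset.sum_comm]
  refine Finset.sum_congr rfl fun y _ => ?_
  rw [Finset.mul_sum]
  refine Fintype.sum_equiv (Equiv.subRight y) _ _ fun x => ?_
  have hγ : γ x = γ y * γ (x - y) := by rw [← AddChar.map_add_eq_mul, add_sub_cancel]
  rw [Equiv.subRight_apply, hγ]
  ring

lemma ft_shift (u : G → ℝ) (t : G) (γ : AddChar G ℂ) :
    ft (fun x => u (x + t)) γ = γ (-t) * ft u γ := by
  simp only [ft, Finset.mul_sum]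
  refine Fintype.sum_equiv (Equiv.addRight t) _ _ fun x => ?_
  have hγ : γ x = γ (-t) * γ (x + t) := by
    rw [← AddChar.map_add_eq_mul, neg_add_cancel_comm_assoc]
  rw [Equiv.coe_addRight, hγ]
  ring

lemma ft_inversion (u : G → ℝ) (x : G) :
    ∑ γ : AddChar G ℂ, ft u γ * γ (-x) = Fintype.card G * (u x : ℂ) := by
  classical
  have orthogonality (y : G) : ∑ γ : AddChar G ℂ, (u y : ℂ) * γ y * γ (-x)
      = if y = x then (u y : ℂ) * Fintype.card G else 0 := by
    simp_rw [mul_assoc, ← AddChar.map_add_eq_mul, ← Finset.mul_sum, ← sub_eq_add_neg]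
    rw [AddChar.sum_apply_eq_ite (y - x)]
    simp only [sub_eq_zero, mul_ite, mul_zero]
  simp_rw [ft, Finset.sum_mul]
  rw [Finset.sum_comm]
  simp_rw [orthogonality]
  rw [Finset.sum_ite_eq' Finset.univ, if_pos (Finset.mem_univ x), mul_comm]

lemma ft_parseval (u : G → ℝ) :
    ∑ γ : AddChar G ℂ, ‖ft u γ‖ ^ 2 = Fintype.card G * ∑ x, u x ^ 2 := by
  have hconj (γ : AddChar G ℂ) : (starRingEnd ℂ) (ft u γ) = ∑ x, (u x : ℂ) * γ (-x) := by
    simp only [ft, map_sum, map_mul, Complex.conj_ofReal, AddChar.map_neg_eq_conj]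
  have key : ∑ γ : AddChar G ℂ, (‖ft u γ‖ : ℂ) ^ 2
      = Fintype.card G * ∑ x, (u x : ℂ) ^ 2 :=
    calc ∑ γ : AddChar G ℂ, (‖ft u γ‖ : ℂ) ^ 2
        = ∑ γ : AddChar G ℂ, ∑ x, (u x : ℂ) * (ft u γ * γ (-x)) := by
          refine Finset.sum_congr rfl fun γ _ => ?_
          rw [← Complex.mul_conj', hconj, Finset.mul_sum]
          exact Finset.sum_congr rfl fun x _ => by ring
      _ = ∑ x, (u x : ℂ) * (Fintype.card G * (u x : ℂ)) := by
          rw [Finset.sum_comm]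
          simp_rw [← Finset.mul_sum, ft_inversion]
      _ = Fintype.card G * ∑ x, (u x : ℂ) ^ 2 := by
          rw [Finset.mul_sum]
          exact Finset.sum_congr rfl fun x _ => by ring
  exact_mod_cast key

lemma norm_ft_le {u : G → ℝ} (hu : ∀ x, 0 ≤ u x) (γ : AddChar G ℂ) : ‖ft u γ‖ ≤ ∑ x, u x := by
  refine (norm_sum_le _ _).trans (Finset.sum_le_sum fun x _ => ?_)
  rw [norm_mul, AddChar.norm_apply, mul_one, Complex.norm_real, Real.norm_of_nonneg (hu x)]

lemma abs_shift_sub_le (u : G → ℝ) (x t : G) :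
    Fintype.card G * |u (x + t) - u x| ≤ ∑ γ : AddChar G ℂ, ‖ft u γ‖ * ‖γ t - 1‖ := by
  have hdiff : (Fintype.card G : ℂ) * ((u (x + t) : ℂ) - u x)
      = ∑ γ : AddChar G ℂ, ft u γ * (γ (-(x + t)) * (1 - γ t)) := by
    rw [mul_sub, ← ft_inversion, ← ft_inversion, ← Finset.sum_sub_distrib]
    refine Finset.sum_congr rfl fun γ _ => ?_
    rw [mul_sub, mul_sub, ← AddChar.map_add_eq_mul, mul_one, neg_add, neg_add_cancel_right]
  calc Fintype.card G * |u (x + t) - u x|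
      = ‖(Fintype.card G : ℂ) * ((u (x + t) : ℂ) - u x)‖ := by
        rw [norm_mul, ← Complex.ofReal_sub, Complex.norm_real, Complex.norm_natCast,
          Real.norm_eq_abs]
    _ ≤ ∑ γ : AddChar G ℂ, ‖ft u γ * (γ (-(x + t)) * (1 - γ t))‖ := hdiff ▸ norm_sum_le _ _
    _ = ∑ γ : AddChar G ℂ, ‖ft u γ‖ * ‖γ t - 1‖ := by
        simp_rw [norm_mul, AddChar.norm_apply, one_mul, norm_sub_rev (1 : ℂ)]

end Fourier

section UniformWeight

variable {G : Type*} [DecidableEq G]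

lemma ind_nonneg (X : Finset G) (x : G) : 0 ≤ ind X x := by
  unfold ind
  split_ifs <;> norm_num

lemma ind_le_one (X : Finset G) (x : G) : ind X x ≤ 1 := by
  unfold ind
  split_ifs <;> norm_num

lemma unif_nonneg (X : Finset G) (x : G) : 0 ≤ unif X x :=
  div_nonneg (ind_nonneg X x) (Nat.cast_nonneg _)

variable [Fintype G]

lemma sum_unif_mul (X : Finset G) (u : G → ℝ) :
    ∑ x, unif X x * u x = (∑ x ∈ X, u x) / X.card := by
  simp only [unif, ind, div_mul_eq_mul_div, ite_mul, one_mul, zero_mul, ← Finset.sum_div,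
    Finset.sum_ite_mem, Finset.univ_inter]

lemma sum_unif {X : Finset G} (hX : X.Nonempty) : ∑ x, unif X x = 1 := by
  have hcard : (X.card : ℝ) ≠ 0 := Nat.cast_ne_zero.2 hX.card_ne_zero
  simpa [hcard] using sum_unif_mul X fun _ => 1

lemma sum_ind_sq (X : Finset G) : ∑ x, ind X x ^ 2 = X.card := by
  simp [ind]

lemma sum_unif_sq (X : Finset G) : ∑ x, unif X x ^ 2 = 1 / X.card := by
  simp_rw [unif, div_pow, ← Finset.sum_div, sum_ind_sq]
  rw [sq, div_self_mul_self', one_div]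

variable [AddCommGroup G]

lemma norm_ft_unif_le_one (X : Finset G) (γ : AddChar G ℂ) : ‖ft (unif X) γ‖ ≤ 1 := by
  rcases X.eq_empty_or_nonempty with rfl | hX
  · simp [ft, unif, ind]
  · exact (norm_ft_le (unif_nonneg X) γ).trans (sum_unif hX).le

lemma sum_norm_ft_conv_unif_ind_le (A L : Finset G) :
    ∑ γ : AddChar G ℂ, ‖ft (conv (unif A) (ind L)) γ‖
      ≤ Fintype.card G * √(L.card / A.card) := by
  simp_rw [ft_conv, norm_mul]
  refine (Real.sum_mul_le_sqrt_mul_sqrt _ _ _).trans_eq ?_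
  rw [ft_parseval, ft_parseval, sum_unif_sq, sum_ind_sq, ← Real.sqrt_mul (by positivity),
    show (Fintype.card G : ℝ) * (1 / A.card) * (Fintype.card G * L.card)
      = (Fintype.card G : ℝ) ^ 2 * (L.card / A.card) by ring,
    Real.sqrt_mul (by positivity), Real.sqrt_sq (by positivity)]

end UniformWeight

section BohrSets

variable {G : Type*} [AddCommGroup G]

lemma bohr_mono (Γ : Finset (AddChar G ℂ)) {ρ σ : ℝ} (h : ρ ≤ σ) : bohr Γ ρ ⊆ bohr Γ σ :=
  fun _ hx γ hγ => (hx γ hγ).trans h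

lemma zero_mem_bohr (Γ : Finset (AddChar G ℂ)) {ρ : ℝ} (h : 0 ≤ ρ) : (0 : G) ∈ bohr Γ ρ :=
  fun γ _ => by simpa using h

variable [Finite G]

lemma norm_char_sub_sub_one (γ : AddChar G ℂ) (x y : G) : ‖γ (x - y) - 1‖ = ‖γ x - γ y‖ := by
  have h : γ x - γ y = γ y * (γ (x - y) - 1) := by
    rw [mul_sub, ← AddChar.map_add_eq_mul, add_sub_cancel, mul_one]
  rw [h, norm_mul, AddChar.norm_apply, one_mul]

lemma norm_char_neg_sub_one (γ : AddChar G ℂ) (x : G) : ‖γ (-x) - 1‖ = ‖γ x - 1‖ := by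
  rw [← zero_sub, norm_char_sub_sub_one, AddChar.map_zero_eq_one, norm_sub_rev]

lemma add_mem_bohr {Γ : Finset (AddChar G ℂ)} {ρ σ : ℝ} {x y : G} (hx : x ∈ bohr Γ ρ)
    (hy : y ∈ bohr Γ σ) : x + y ∈ bohr Γ (ρ + σ) := fun γ hγ =>
  calc ‖γ (x + y) - 1‖ = ‖γ x - γ (-y)‖ := by rw [← norm_char_sub_sub_one, sub_neg_eq_add]
    _ ≤ ‖γ x - 1‖ + ‖1 - γ (-y)‖ := norm_sub_le_norm_sub_add_norm_sub _ _ _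
    _ ≤ ρ + σ := by
      rw [norm_sub_rev 1, norm_char_neg_sub_one]
      exact add_le_add (hx γ hγ) (hy γ hγ)

lemma neg_mem_bohr {Γ : Finset (AddChar G ℂ)} {ρ : ℝ} {x : G} (hx : x ∈ bohr Γ ρ) :
    -x ∈ bohr Γ ρ :=
  fun γ hγ => (norm_char_neg_sub_one γ x).trans_le (hx γ hγ)

lemma ncard_bohr_pos (Γ : Finset (AddChar G ℂ)) {ρ : ℝ} (h : 0 ≤ ρ) : 0 < (bohr Γ ρ).ncard :=
  (Set.ncard_pos (Set.toFinite _)).2 ⟨0, zero_mem_bohr Γ h⟩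

lemma ncard_bohr_mono (Γ : Finset (AddChar G ℂ)) {ρ σ : ℝ} (h : ρ ≤ σ) :
    (bohr Γ ρ).ncard ≤ (bohr Γ σ).ncard :=
  Set.ncard_le_ncard (bohr_mono Γ h) (Set.toFinite _)

/-- The Bohr set `bohr Γ ρ` as a finset, for use in finite sums. -/
noncomputable def bohrFin (Γ : Finset (AddChar G ℂ)) (ρ : ℝ) : Finset G :=
  (Set.toFinite (bohr Γ ρ)).toFinset

@[simp] lemma mem_bohrFin {Γ : Finset (AddChar G ℂ)} {ρ : ℝ} {x : G} :
    x ∈ bohrFin Γ ρ ↔ x ∈ bohr Γ ρ :=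
  Set.Finite.mem_toFinset _

lemma bohrFin_nonempty (Γ : Finset (AddChar G ℂ)) {ρ : ℝ} (h : 0 ≤ ρ) : (bohrFin Γ ρ).Nonempty :=
  ⟨0, mem_bohrFin.2 (zero_mem_bohr Γ h)⟩

lemma card_bohrFin (Γ : Finset (AddChar G ℂ)) (ρ : ℝ) :
    (bohrFin Γ ρ).card = (bohr Γ ρ).ncard :=
  (Set.ncard_eq_toFinset_card _ (Set.toFinite _)).symm

end BohrSets

section Packing

open MeasureTheory Metric Module

lemma sum_indicator_closedBall_le {ι E : Type*} [PseudoMetricSpace E] {s : Finset ι} {p : ι → E}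
    {c : E} {ρ r : ℝ} {M : ℕ} (hp : ∀ x ∈ s, dist (p x) c ≤ ρ)
    (hM : ∀ x ∈ s, (s.filter fun y => dist (p y) (p x) ≤ r).card ≤ M) (z : E) :
    ∑ x ∈ s, (closedBall (p x) (r / 2)).indicator (1 : E → ENNReal) z
      ≤ (closedBall c (ρ + r / 2)).indicator (fun _ => (M : ENNReal)) z := by
  classical
  have hcount : ∑ x ∈ s, (closedBall (p x) (r / 2)).indicator (1 : E → ENNReal) z
      = (s.filter fun x => z ∈ closedBall (p x) (r / 2)).card := by
    simp [Set.indicator_apply]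
  rw [hcount]
  rcases (s.filter fun x => z ∈ closedBall (p x) (r / 2)).eq_empty_or_nonempty with h | ⟨x, hx⟩
  · rw [h, Finset.card_empty, Nat.cast_zero]
    exact zero_le
  obtain ⟨hxs, hzx⟩ := Finset.mem_filter.1 hx
  rw [mem_closedBall] at hzx
  have hzc : z ∈ closedBall c (ρ + r / 2) := by
    rw [mem_closedBall]
    linarith [dist_triangle z (p x) c, hp x hxs]
  rw [Set.indicator_of_mem hzc, Nat.cast_le]
  refine (Finset.card_le_card ?_).trans (hM x hxs)
  refine Finset.monotone_filter_right s fun y _ hzy => ?_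
  rw [mem_closedBall'] at hzy
  linarith [dist_triangle (p y) z (p x)]

lemma card_le_mul_pow_finrank {ι E : Type*} [NormedAddCommGroup E] [NormedSpace ℝ E]
    [FiniteDimensional ℝ E] {s : Finset ι} {p : ι → E} {c : E} {ρ r : ℝ} {M : ℕ} (hρ : 0 ≤ ρ)
    (hr : 0 < r) (hp : ∀ x ∈ s, dist (p x) c ≤ ρ)
    (hM : ∀ x ∈ s, (s.filter fun y => dist (p y) (p x) ≤ r).card ≤ M) :
    (s.card : ℝ) ≤ M * (1 + 2 * ρ / r) ^ finrank ℝ E := by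
  borelize E
  let vol : Measure E := Measure.addHaar
  have hvol : ∑ x ∈ s, vol (closedBall (p x) (r / 2)) ≤ M * vol (closedBall c (ρ + r / 2)) := by
    have hmeas (x : ι) : Measurable ((closedBall (p x) (r / 2)).indicator (1 : E → ENNReal)) :=
      measurable_one.indicator isClosed_closedBall.measurableSet
    calc ∑ x ∈ s, vol (closedBall (p x) (r / 2))
        = ∫⁻ z, ∑ x ∈ s, (closedBall (p x) (r / 2)).indicator 1 z ∂vol := by
          rw [lintegral_finsetSum _ fun x _ => hmeas x]
          simp_rw [lintegral_indicator_one isClosed_closedBall.measurableSet]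
      _ ≤ ∫⁻ z, (closedBall c (ρ + r / 2)).indicator (fun _ => (M : ENNReal)) z ∂vol :=
          lintegral_mono fun z => sum_indicator_closedBall_le hp hM z
      _ = M * vol (closedBall c (ρ + r / 2)) :=
          lintegral_indicator_const isClosed_closedBall.measurableSet _
  have hreal : (s.card : ℝ) * (r / 2) ^ finrank ℝ E ≤ M * (ρ + r / 2) ^ finrank ℝ E := by
    have hunit : vol (ball 0 1) ≠ 0 := (measure_ball_pos vol 0 one_pos).ne'
    simp only [Measure.addHaar_closedBall vol _ (half_pos hr).le,
      Measure.addHaar_closedBall vol c (add_nonneg hρ (half_pos hr).le), Finset.sum_const,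
      nsmul_eq_mul, ← mul_assoc] at hvol
    rw [ENNReal.mul_le_mul_iff_left hunit measure_ball_lt_top.ne] at hvol
    have := ENNReal.toReal_mono (by finiteness) hvol
    rwa [ENNReal.toReal_mul, ENNReal.toReal_mul, ENNReal.toReal_ofReal (by positivity),
      ENNReal.toReal_ofReal (by positivity), ENNReal.toReal_natCast, ENNReal.toReal_natCast] at this
  have hscale : ρ + r / 2 = (1 + 2 * ρ / r) * (r / 2) := by
    field_simp
    ring
  rw [hscale, mul_pow, ← mul_assoc] at hreal
  exact le_of_mul_le_mul_right hreal (by positivity)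

lemma ncard_bohr_le_pow_mul {G : Type*} [AddCommGroup G] [Finite G] (Γ : Finset (AddChar G ℂ))
    {ρ r : ℝ} (hρ : 0 ≤ ρ) (hr : 0 < r) :
    ((bohr Γ ρ).ncard : ℝ) ≤ (1 + 2 * ρ / r) ^ (2 * Γ.card) * (bohr Γ r).ncard := by
  let p (x : G) (γ : Γ) : ℂ := (γ : AddChar G ℂ) x
  have hp (x : G) (hx : x ∈ bohrFin Γ ρ) : dist (p x) 1 ≤ ρ :=
    (dist_pi_le_iff hρ).2 fun γ => (dist_eq_norm _ _).trans_le (mem_bohrFin.1 hx γ γ.2)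
  have hnear (x : G) :
      ((bohrFin Γ ρ).filter fun y => dist (p y) (p x) ≤ r).card ≤ (bohrFin Γ r).card := by
    refine Finset.card_le_card_of_injOn (· - x) (fun y hy => ?_) (sub_left_injective.injOn)
    refine mem_bohrFin.2 fun γ hγ => ?_
    rw [norm_char_sub_sub_one, ← dist_eq_norm]
    exact (dist_le_pi_dist (p y) (p x) ⟨γ, hγ⟩).trans (Finset.mem_filter.1 hy).2
  have hcard := card_le_mul_pow_finrank hρ hr hp fun x _ => hnear x
  have hrank : finrank ℝ (Γ → ℂ) = 2 * Γ.card := by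
    rw [finrank_pi_fintype, Finset.sum_const, Complex.finrank_real_complex, smul_eq_mul,
      Finset.card_univ, Fintype.card_coe, mul_comm]
  rwa [hrank, card_bohrFin, card_bohrFin, mul_comm] at hcard

end Packing

section LinearGrowth

open MeasureTheory Set

lemma exists_disjoint_Icc_covering {ι : Type*} {t : Set ι} {l r : ι → ℝ} {a b R τ : ℝ}
    (hlr : ∀ i ∈ t, l i < r i) (hR : ∀ i ∈ t, r i - l i ≤ R) (hτ : 3 < τ)
    (hcover : Icc a b ⊆ ⋃ i ∈ t, Icc (l i) (r i)) :
    ∃ I ⊆ t, I.Countable ∧ I.PairwiseDisjoint (fun i => Icc (l i) (r i)) ∧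
      ENNReal.ofReal (b - a) ≤ ∑' i : I, ENNReal.ofReal (τ * (r i - l i)) := by
  obtain ⟨I, hIt, hdisj, hdil⟩ := Vitali.exists_disjoint_subfamily_covering_enlargement_closedBall t
    (fun i => (l i + r i) / 2) (fun i => (r i - l i) / 2) (R / 2)
    (fun i hi => by linarith [hR i hi]) τ hτ
  simp only [← Real.Icc_eq_closedBall] at hdisj
  have hcount : I.Countable := hdisj.countable_of_nonempty_interior fun i hi => by
    rw [interior_Icc, nonempty_Ioo]
    exact hlr i (hIt hi)
  refine ⟨I, hIt, hcount, hdisj, ?_⟩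
  calc ENNReal.ofReal (b - a) = volume (Icc a b) := Real.volume_Icc.symm
    _ ≤ volume (⋃ i ∈ I, Metric.closedBall ((l i + r i) / 2) (τ * ((r i - l i) / 2))) := by
      refine measure_mono (hcover.trans (iUnion₂_subset fun i hi => ?_))
      obtain ⟨j, hj, hij⟩ := hdil i hi
      rw [← Real.Icc_eq_closedBall] at hij
      exact subset_iUnion₂_of_subset j hj hij
    _ ≤ ∑' i : I, volume (Metric.closedBall ((l i + r i) / 2) (τ * ((r i - l i) / 2))) :=
      measure_biUnion_le volume hcount _
    _ = ∑' i : I, ENNReal.ofReal (τ * (r i - l i)) := by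
      simp_rw [Real.volume_closedBall]
      ring_nf

lemma tsum_ofReal_sub_le_of_disjoint_Icc {ι : Type*} {I : Set ι} (hI : I.Countable)
    {l r : ι → ℝ} (hlr : ∀ i ∈ I, l i ≤ r i)
    (hdisj : I.PairwiseDisjoint fun i => Icc (l i) (r i)) {φ : ℝ → ℝ} (hφ : Monotone φ) {p q : ℝ}
    (hp : ∀ x, p ≤ φ x) (hq : ∀ x, φ x ≤ q) :
    ∑' i : I, ENNReal.ofReal (φ (r i) - φ (l i)) ≤ ENNReal.ofReal (q - p) := by
  have hgap : I.PairwiseDisjoint fun i => Ioo (φ (l i)) (φ (r i)) := by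
    intro i hi j hj hij
    refine disjoint_left.2 fun z hzi hzj => ?_
    rcases lt_or_ge (r i) (l j) with h | h
    · exact (hzi.2.trans_le (hφ h.le)).not_gt hzj.1
    rcases lt_or_ge (r j) (l i) with h' | h'
    · exact (hzj.2.trans_le (hφ h'.le)).not_gt hzi.1
    have hmem : max (l i) (l j) ∈ Icc (l i) (r i) := ⟨le_max_left _ _, max_le (hlr i hi) h⟩
    exact disjoint_left.1 (hdisj hi hj hij) hmem ⟨le_max_right _ _, max_le h' (hlr j hj)⟩
  calc ∑' i : I, ENNReal.ofReal (φ (r i) - φ (l i))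
      = volume (⋃ i ∈ I, Ioo (φ (l i)) (φ (r i))) := by
        rw [measure_biUnion hI hgap fun _ _ => measurableSet_Ioo]
        simp_rw [Real.volume_Ioo]
    _ ≤ volume (Icc p q) :=
        measure_mono (iUnion₂_subset fun i _ => Ioo_subset_Icc_self.trans
          (Icc_subset_Icc (hp _) (hq _)))
    _ = ENNReal.ofReal (q - p) := Real.volume_Icc

lemma mul_length_le_of_steep_cover {φ : ℝ → ℝ} (hφ : Monotone φ) {p q : ℝ} (hp : ∀ x, p ≤ φ x)
    (hq : ∀ x, φ x ≤ q) {ι : Type*} {t : Set ι} {l r : ι → ℝ} {α τ a b : ℝ} (hα : 0 < α)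
    (hτ : 3 < τ) (hlr : ∀ i ∈ t, l i < r i)
    (hsteep : ∀ i ∈ t, α * (r i - l i) ≤ φ (r i) - φ (l i))
    (hcover : Icc a b ⊆ ⋃ i ∈ t, Icc (l i) (r i)) : α * (b - a) ≤ τ * (q - p) := by
  have hlen (i : ι) (hi : i ∈ t) : r i - l i ≤ (q - p) / α := by
    rw [le_div_iff₀' hα]
    linarith [hsteep i hi, hp (l i), hq (r i)]
  obtain ⟨I, hI, hcount, hdisj, hsum⟩ := exists_disjoint_Icc_covering hlr hlen hτ hcover
  have hτα : 0 ≤ τ / α := div_nonneg (by linarith) hα.le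
  have hpq : p ≤ q := (hp 0).trans (hq 0)
  have hlength : ENNReal.ofReal (b - a) ≤ ENNReal.ofReal (τ / α * (q - p)) :=
    calc ENNReal.ofReal (b - a)
        ≤ ∑' i : I, ENNReal.ofReal (τ * (r i - l i)) := hsum
      _ ≤ ∑' i : I, ENNReal.ofReal (τ / α) * ENNReal.ofReal (φ (r i) - φ (l i)) := by
          refine ENNReal.tsum_le_tsum fun i => ?_
          rw [← ENNReal.ofReal_mul hτα, div_mul_eq_mul_div, mul_div_assoc]
          refine ENNReal.ofReal_le_ofReal (mul_le_mul_of_nonneg_left ?_ (by linarith))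
          rw [le_div_iff₀' hα]
          exact hsteep i (hI i.2)
      _ ≤ ENNReal.ofReal (τ / α * (q - p)) := by
          rw [ENNReal.tsum_mul_left, ENNReal.ofReal_mul hτα]
          gcongr
          exact tsum_ofReal_sub_le_of_disjoint_Icc hcount (fun i hi => (hlr i (hI hi)).le) hdisj
            hφ hp hq
  rwa [ENNReal.ofReal_le_ofReal_iff (mul_nonneg hτα (sub_nonneg.2 hpq)), div_mul_eq_mul_div,
    le_div_iff₀' hα] at hlength

lemma exists_linear_growth_point {φ : ℝ → ℝ} (hφ : Monotone φ) {p q α a b : ℝ}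
    (hp : ∀ x, p ≤ φ x) (hq : ∀ x, φ x ≤ q) (hα : 0 < α) (hgrowth : 3 * (q - p) < α * (b - a)) :
    ∃ u ∈ Icc a b, ∀ v, |φ v - φ u| ≤ α * |v - u| := by
  by_contra! hsteep
  choose! v hv using hsteep
  have hsteep (u : ℝ) (hu : u ∈ Icc a b) :
      α * (max u (v u) - min u (v u)) < φ (max u (v u)) - φ (min u (v u)) := by
    rw [hφ.map_max, hφ.map_min, max_sub_min_eq_abs, max_sub_min_eq_abs]
    exact hv u hu
  have hne (u : ℝ) (hu : u ∈ Icc a b) : min u (v u) < max u (v u) := by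
    refine inf_lt_sup.2 fun h => ?_
    have := hv u hu
    simp [← h] at this
  have hab : a ≤ b := by
    have : p ≤ q := (hp 0).trans (hq 0)
    nlinarith
  have hpq : 0 < q - p := by
    have ha : a ∈ Icc a b := left_mem_Icc.2 hab
    linarith [hsteep a ha, mul_pos hα (sub_pos.2 (hne a ha)), hq (max a (v a)), hp (min a (v a))]
  obtain ⟨τ, hτ, hτq⟩ := exists_between ((lt_div_iff₀ hpq).2 hgrowth)
  refine ((lt_div_iff₀ hpq).1 hτq).not_ge ?_
  exact mul_length_le_of_steep_cover hφ hp hq hα hτ hne (fun u hu => (hsteep u hu).le)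
    fun u hu => mem_biUnion hu ⟨min_le_left _ _, le_max_left _ _⟩

lemma exists_log_lipschitz_point {N : ℝ → ℝ} (hN : MonotoneOn N (Ioi 0)) {ρ α : ℝ} (hρ : 0 < ρ)
    (hα : 0 < α) (hgrowth : 3 * (N ρ - N (ρ / 2 ^ 13)) < α * (11 * Real.log 2)) :
    ∃ σ ∈ Icc (ρ / 2 ^ 12) (ρ / 2), ∀ s ∈ Icc (ρ / 2 ^ 13) ρ,
      |N s - N σ| ≤ α * |Real.log s - Real.log σ| := by
  have hsmall : 0 < ρ / 2 ^ 13 := by positivity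
  have hsmall_le : ρ / 2 ^ 13 ≤ ρ := div_le_self hρ.le (by norm_num)
  let clamp (u : ℝ) : ℝ := max (ρ / 2 ^ 13) (min (Real.exp u) ρ)
  have hclamp_pos (u : ℝ) : 0 < clamp u := lt_max_of_lt_left hsmall
  have hclamp_log {s : ℝ} (hs : s ∈ Icc (ρ / 2 ^ 13) ρ) : clamp (Real.log s) = s := by
    simp only [clamp]
    rw [Real.exp_log (hsmall.trans_le hs.1), min_eq_left hs.2, max_eq_right hs.1]
  have hmono : Monotone fun u => N (clamp u) := fun u v huv =>
    hN (hclamp_pos u) (hclamp_pos v)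
      (max_le_max_left _ (min_le_min_right _ (Real.exp_le_exp.2 huv)))
  have hlength : Real.log (ρ / 2) - Real.log (ρ / 2 ^ 12) = 11 * Real.log 2 := by
    rw [Real.log_div hρ.ne' two_ne_zero, Real.log_div hρ.ne' (by positivity), Real.log_pow]
    push_cast
    ring
  obtain ⟨u, hu, hlip⟩ := exists_linear_growth_point hmono
    (fun u => hN hsmall (hclamp_pos u) (le_max_left _ _))
    (fun u => hN (hclamp_pos u) hρ (max_le hsmall_le (min_le_right _ _))) hα
    (hgrowth.trans_eq (by rw [hlength]))
  have hσ : Real.exp u ∈ Icc (ρ / 2 ^ 12) (ρ / 2) :=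
    ⟨(Real.log_le_iff_le_exp (by positivity)).1 hu.1,
      (Real.le_log_iff_exp_le (by positivity)).1 hu.2⟩
  have hσ' : Real.exp u ∈ Icc (ρ / 2 ^ 13) ρ :=
    ⟨le_trans (by gcongr <;> norm_num) hσ.1, hσ.2.trans (half_le_self hρ.le)⟩
  refine ⟨Real.exp u, hσ, fun s hs => ?_⟩
  have hclamp_u : clamp u = Real.exp u := by simpa only [Real.log_exp] using hclamp_log hσ'
  simpa only [hclamp_log hs, hclamp_u, Real.log_exp] using hlip (Real.log s)

end LinearGrowth

section RegularBohrSets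

variable {G : Type*} [AddCommGroup G] [Finite G]

lemma exp_two_thirds_mul_le {x : ℝ} (h0 : 0 ≤ x) (h1 : x ≤ 1) :
    Real.exp (2 / 3 * x) ≤ 1 + x :=
  calc Real.exp (2 / 3 * x) ≤ (2 : ℝ) ^ x := by
        rw [Real.rpow_def_of_pos two_pos]
        refine Real.exp_le_exp.2 (mul_le_mul_of_nonneg_right ?_ h0)
        linarith [Real.log_two_gt_d9]
    _ ≤ 1 + x := by
        simpa [one_add_one_eq_two] using
          rpow_one_add_le_one_add_mul_self (s := 1) (by norm_num) h0 h1

lemma abs_log_one_add_le {τ : ℝ} (h : |τ| ≤ 1 / 12) : |Real.log (1 + τ)| ≤ 12 / 11 * |τ| := by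
  obtain ⟨hl, hu⟩ := abs_le.1 h
  have hpos : 0 < 1 + τ := by linarith
  rcases le_total 0 τ with h0 | h0
  · rw [abs_of_nonneg h0, abs_of_nonneg (Real.log_nonneg (by linarith))]
    linarith [Real.log_le_sub_one_of_pos hpos]
  · rw [abs_of_nonpos h0, abs_of_nonpos (Real.log_nonpos hpos.le (by linarith))]
    have hinv : (1 + τ)⁻¹ ≤ 1 - 12 / 11 * τ := inv_le_of_inv_le₀ (by linarith) <| by
      rw [inv_le_iff_one_le_mul₀ (by linarith)]
      nlinarith
    linarith [Real.one_sub_inv_le_log_of_pos hpos]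

namespace BohrSet

lemma isRegular_of_radius_eq_zero {B : BohrSet G} (hB : B.radius = 0) : B.IsRegular := by
  intro τ _
  have hdil : B.dilate (1 + τ) = B.carrier := by rw [dilate, carrier, hB, mul_zero]
  have hpos : (B.carrier.ncard : ℝ) ≠ 0 := by
    exact_mod_cast (ncard_bohr_pos B.freqs B.radius_nonneg).ne'
  rw [hdil, div_self hpos]
  have : 0 ≤ 12 * (B.rank : ℝ) * |τ| := by positivity
  constructor <;> linarith

lemma isRegular_of_abs_log_sub_le {B : BohrSet G} (hd : 1 ≤ B.rank)
    (h : ∀ τ : ℝ, |τ| ≤ 1 / 12 →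
      |Real.log (B.dilate (1 + τ)).ncard - Real.log B.carrier.ncard|
        ≤ 8 * B.rank * |Real.log (1 + τ)|) : B.IsRegular := by
  intro τ hτ
  have hd' : (1 : ℝ) ≤ B.rank := by exact_mod_cast hd
  have hτ' : |τ| ≤ 1 / 12 := by nlinarith [abs_nonneg τ]
  have hrad : 0 ≤ (1 + τ) * B.radius :=
    mul_nonneg (by linarith [neg_abs_le τ]) B.radius_nonneg
  have hN : (0 : ℝ) < B.carrier.ncard := by
    exact_mod_cast ncard_bohr_pos B.freqs B.radius_nonneg
  have hN' : (0 : ℝ) < (B.dilate (1 + τ)).ncard := by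
    exact_mod_cast ncard_bohr_pos B.freqs hrad
  obtain ⟨hlower, hupper⟩ := abs_le.1 (h τ hτ')
  rw [← Real.log_div hN'.ne' hN.ne'] at hlower hupper
  have hratio : (0 : ℝ) < (B.dilate (1 + τ)).ncard / B.carrier.ncard := div_pos hN' hN
  constructor
  · rw [← Real.exp_log hratio]
    have := mul_le_mul_of_nonneg_left (abs_log_one_add_le hτ')
      (by positivity : (0 : ℝ) ≤ 8 * B.rank)
    have : 0 ≤ B.rank * |τ| := by positivity
    linarith [Real.add_one_le_exp (Real.log ((B.dilate (1 + τ)).ncard / B.carrier.ncard))]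
  rcases le_total τ 0 with h0 | h0
  · have hmono : ((B.dilate (1 + τ)).ncard : ℝ) ≤ B.carrier.ncard := by
      exact_mod_cast ncard_bohr_mono B.freqs (by nlinarith [B.radius_nonneg])
    refine ((div_le_one hN).2 hmono).trans ?_
    linarith [(by positivity : 0 ≤ 12 * B.rank * |τ|)]
  · refine le_trans ?_ (exp_two_thirds_mul_le (by positivity) hτ)
    rw [← Real.log_le_iff_le_exp hratio]
    refine hupper.trans ?_
    have hlog : |Real.log (1 + τ)| ≤ |τ| := by
      rw [abs_of_nonneg (Real.log_nonneg (by linarith)), abs_of_nonneg h0]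
      linarith [Real.log_le_sub_one_of_pos (by linarith : 0 < 1 + τ)]
    linarith [mul_le_mul_of_nonneg_left hlog (by positivity : (0 : ℝ) ≤ 8 * B.rank)]

end BohrSet

lemma log_ncard_bohr_sub_le {Γ : Finset (AddChar G ℂ)} {ρ : ℝ} (hρ : 0 < ρ) :
    Real.log (bohr Γ ρ).ncard - Real.log (bohr Γ (ρ / 2 ^ 13)).ncard
      ≤ 29 * Γ.card * Real.log 2 := by
  have hpos (s : ℝ) (hs : 0 < s) : (0 : ℝ) < (bohr Γ s).ncard := by
    exact_mod_cast ncard_bohr_pos Γ hs.le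
  have hsmall : 0 < ρ / 2 ^ 13 := by positivity
  have hpack := ncard_bohr_le_pow_mul Γ hρ.le hsmall
  have hratio : 1 + 2 * ρ / (ρ / 2 ^ 13) = 1 + 2 ^ 14 := by
    field_simp
  rw [hratio, pow_mul] at hpack
  have hbound : ((bohr Γ ρ).ncard : ℝ) ≤ (2 ^ 29) ^ Γ.card * (bohr Γ (ρ / 2 ^ 13)).ncard := by
    refine hpack.trans ?_
    gcongr
    norm_num
  have hlog := Real.log_le_log (hpos ρ hρ) hbound
  rw [Real.log_mul (by positivity) (hpos _ hsmall).ne', Real.log_pow, Real.log_pow] at hlog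
  push_cast at hlog
  linarith

lemma exists_log_lipschitz_radius {Γ : Finset (AddChar G ℂ)} (hΓ : Γ.Nonempty) {ρ : ℝ}
    (hρ : 0 < ρ) :
    ∃ σ ∈ Set.Icc (ρ / 2 ^ 12) (ρ / 2), ∀ s ∈ Set.Icc (ρ / 2 ^ 13) ρ,
      |Real.log (bohr Γ s).ncard - Real.log (bohr Γ σ).ncard|
        ≤ 8 * Γ.card * |Real.log s - Real.log σ| := by
  have hcard : (1 : ℝ) ≤ Γ.card := by exact_mod_cast hΓ.card_pos
  refine exists_log_lipschitz_point (N := fun s => Real.log (bohr Γ s).ncard) ?_ hρ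
    (by positivity) ?_
  · intro s hs s' _ h
    exact Real.log_le_log (by exact_mod_cast ncard_bohr_pos Γ (le_of_lt hs))
      (by exact_mod_cast ncard_bohr_mono Γ h)
  · have := mul_pos (one_pos.trans_le hcard) (Real.log_pos one_lt_two)
    linarith [log_ncard_bohr_sub_le (Γ := Γ) hρ]

lemma exists_regular_dilate {Γ : Finset (AddChar G ℂ)} (hΓ : Γ.Nonempty) {ρ : ℝ} (hρ : 0 ≤ ρ) :
    ∃ B : BohrSet G, B.freqs = Γ ∧ ρ / 4096 ≤ B.radius ∧ B.radius ≤ ρ ∧ B.IsRegular := by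
  rcases hρ.eq_or_lt with rfl | hρ
  · exact ⟨⟨Γ, 0, le_rfl⟩, rfl, by simp, le_rfl, BohrSet.isRegular_of_radius_eq_zero rfl⟩
  obtain ⟨σ, ⟨hσl, hσu⟩, hlip⟩ := exists_log_lipschitz_radius hΓ hρ
  norm_num at hσl hlip
  have hσ : 0 < σ := lt_of_lt_of_le (by positivity) hσl
  refine ⟨⟨Γ, σ, hσ.le⟩, rfl, hσl, by linarith,
    BohrSet.isRegular_of_abs_log_sub_le hΓ.card_pos fun τ hτ => ?_⟩
  obtain ⟨hτl, hτu⟩ := abs_le.1 hτ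
  have hlog : Real.log ((1 + τ) * σ) - Real.log σ = Real.log (1 + τ) := by
    rw [Real.log_mul (by linarith) hσ.ne', add_sub_cancel_right]
  rw [← hlog]
  exact hlip _ (by nlinarith) (by nlinarith)

end RegularBohrSets

section RieszProducts

variable {G : Type*} [AddCommGroup G]

/-- The Riesz product `∏ (1 + Re (z(γ) γ(x)))` over `γ ∈ Λ`. -/
def rieszProduct (Λ : Finset (AddChar G ℂ)) (z : AddChar G ℂ → ℂ) (x : G) : ℝ :=
  ∏ γ ∈ Λ, (1 + (z γ * γ x).re)

lemma mul_rieszProduct_insert [DecidableEq (AddChar G ℂ)] (u : G → ℝ) {Λ : Finset (AddChar G ℂ)}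
    {γ : AddChar G ℂ} (hγ : γ ∉ Λ) (z : AddChar G ℂ → ℂ) :
    (fun x => u x * rieszProduct (insert γ Λ) z x)
      = fun x => u x * rieszProduct Λ z x * (1 + (z γ * γ x).re) := by
  funext x
  rw [rieszProduct, Finset.prod_insert hγ, rieszProduct]
  ring

variable [Fintype G]

/-- `Λ` is dissociated relative to the weight `β` at level `2 ^ (-n)`: the transform of `β` is at
most `2 ^ (-n)` at each nontrivial product of the characters in `Λ` with exponents in
`{-1, 0, 1}`. -/
def DissociatedRel (β : G → ℝ) (n : ℕ) (Λ : Finset (AddChar G ℂ)) : Prop :=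
  ∀ e : AddChar G ℂ → SignType, (∃ γ ∈ Λ, e γ ≠ 0) →
    ‖ft β (∏ γ ∈ Λ, γ ^ (e γ : ℤ))‖ ≤ (2 ^ n)⁻¹

lemma ft_mul_one_add_re (u : G → ℝ) (c : ℂ) (γ ψ : AddChar G ℂ) :
    ft (fun x => u x * (1 + (c * γ x).re)) ψ
      = ft u ψ + c / 2 * ft u (ψ * γ) + (starRingEnd ℂ) c / 2 * ft u (ψ * γ⁻¹) := by
  simp only [ft, Finset.mul_sum, ← Finset.sum_add_distrib]
  refine Finset.sum_congr rfl fun x _ => ?_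
  have hre : ((c * γ x).re : ℂ) = (c * γ x + (starRingEnd ℂ) c * γ (-x)) / 2 := by
    rw [AddChar.map_neg_eq_conj, ← map_mul, Complex.add_conj]
    push_cast
    ring
  rw [AddChar.mul_apply, AddChar.mul_apply, AddChar.inv_apply]
  push_cast
  rw [hre]
  ring

lemma norm_ft_mul_one_add_re_sub_le {u : G → ℝ} {c : ℂ} (hc : ‖c‖ ≤ 1) {γ ψ : AddChar G ℂ} {M : ℝ}
    (h₁ : ‖ft u (ψ * γ)‖ ≤ M) (h₂ : ‖ft u (ψ * γ⁻¹)‖ ≤ M) :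
    ‖ft (fun x => u x * (1 + (c * γ x).re)) ψ - ft u ψ‖ ≤ M := by
  rw [ft_mul_one_add_re, add_assoc, add_sub_cancel_left]
  have : 0 ≤ M := (norm_nonneg _).trans h₁
  calc ‖c / 2 * ft u (ψ * γ) + (starRingEnd ℂ) c / 2 * ft u (ψ * γ⁻¹)‖
      ≤ ‖c‖ / 2 * ‖ft u (ψ * γ)‖ + ‖c‖ / 2 * ‖ft u (ψ * γ⁻¹)‖ := by
        refine (norm_add_le _ _).trans_eq ?_
        rw [norm_mul, norm_mul, norm_div, norm_div, RCLike.norm_conj, Complex.norm_ofNat]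
    _ ≤ 1 / 2 * M + 1 / 2 * M := by gcongr
    _ = M := by ring

lemma norm_ft_mul_rieszProduct_le {u : G → ℝ} {z : AddChar G ℂ → ℂ} (hz : ∀ γ, ‖z γ‖ ≤ 1)
    {M : ℝ} (Λ : Finset (AddChar G ℂ)) (ψ : AddChar G ℂ)
    (h : ∀ e : AddChar G ℂ → SignType, ‖ft u (ψ * ∏ γ ∈ Λ, γ ^ (e γ : ℤ))‖ ≤ M) :
    ‖ft (fun x => u x * rieszProduct Λ z x) ψ‖ ≤ 2 ^ Λ.card * M := by
  classical
  induction Λ using Finset.induction_on generalizing ψ with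
  | empty => simpa [rieszProduct] using h 0
  | insert γ Λ hγ ih =>
    have hsign (s : SignType) (e : AddChar G ℂ → SignType) :
        ‖ft u (ψ * γ ^ (s : ℤ) * ∏ χ ∈ Λ, χ ^ (e χ : ℤ))‖ ≤ M := by
      have hprod : ∏ χ ∈ Λ, χ ^ (Function.update e γ s χ : ℤ) = ∏ χ ∈ Λ, χ ^ (e χ : ℤ) :=
        Finset.prod_congr rfl fun χ hχ => by
          rw [Function.update_of_ne (ne_of_mem_of_not_mem hχ hγ)]
      have := h (Function.update e γ s)
      rwa [Finset.prod_insert hγ, Function.update_self, hprod, ← mul_assoc] at this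
    have hψ (s : SignType) := ih (ψ * γ ^ (s : ℤ)) (hsign s)
    have h₀ := hψ 0
    have h₁ := hψ 1
    have h₂ := hψ (-1)
    simp only [SignType.coe_zero, SignType.coe_one, SignType.coe_neg_one, zpow_zero, zpow_one,
      zpow_neg_one, mul_one] at h₀ h₁ h₂
    rw [mul_rieszProduct_insert u hγ, Finset.card_insert_of_notMem hγ, pow_succ]
    linarith [norm_le_norm_sub_add
      (ft (fun x => u x * rieszProduct Λ z x * (1 + (z γ * γ x).re)) ψ)
      (ft (fun x => u x * rieszProduct Λ z x) ψ), norm_ft_mul_one_add_re_sub_le (hz γ) h₁ h₂]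

lemma norm_ft_mul_rieszProduct_sub_le {u : G → ℝ} {z : AddChar G ℂ → ℂ} (hz : ∀ γ, ‖z γ‖ ≤ 1)
    {M : ℝ} (Λ : Finset (AddChar G ℂ))
    (h : ∀ e : AddChar G ℂ → SignType, (∃ γ ∈ Λ, e γ ≠ 0) →
      ‖ft u (∏ γ ∈ Λ, γ ^ (e γ : ℤ))‖ ≤ M) :
    ‖ft (fun x => u x * rieszProduct Λ z x) 1 - ft u 1‖ ≤ (2 ^ Λ.card - 1) * M := by
  classical
  induction Λ using Finset.induction_on with
  | empty => simp [rieszProduct]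
  | insert γ Λ hγ ih =>
    have hprod (s : SignType) (e : AddChar G ℂ → SignType) :
        ∏ χ ∈ insert γ Λ, χ ^ (Function.update e γ s χ : ℤ)
          = γ ^ (s : ℤ) * ∏ χ ∈ Λ, χ ^ (e χ : ℤ) := by
      rw [Finset.prod_insert hγ, Function.update_self]
      congr 1
      exact Finset.prod_congr rfl fun χ hχ => by
        rw [Function.update_of_ne (ne_of_mem_of_not_mem hχ hγ)]
    have hΛ := ih fun e ⟨χ, hχ, he⟩ => by
      have := h (Function.update e γ 0) ⟨χ, Finset.mem_insert_of_mem hχ, by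
        rwa [Function.update_of_ne (ne_of_mem_of_not_mem hχ hγ)]⟩
      rwa [hprod, SignType.coe_zero, zpow_zero, one_mul] at this
    have hγs (s : SignType) (hs : s ≠ 0) :=
      norm_ft_mul_rieszProduct_le hz Λ (γ ^ (s : ℤ)) fun e => by
        have := h (Function.update e γ s)
          ⟨γ, Finset.mem_insert_self γ Λ, by rwa [Function.update_self]⟩
        rwa [hprod] at this
    have h₁ := hγs 1 (by decide)
    have h₂ := hγs (-1) (by decide)
    simp only [SignType.coe_one, SignType.coe_neg_one, zpow_one, zpow_neg_one] at h₁ h₂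
    rw [← one_mul γ] at h₁
    rw [← one_mul γ⁻¹] at h₂
    rw [mul_rieszProduct_insert u hγ, Finset.card_insert_of_notMem hγ, pow_succ]
    linarith [norm_sub_le_norm_sub_add_norm_sub
      (ft (fun x => u x * rieszProduct Λ z x * (1 + (z γ * γ x).re)) 1)
      (ft (fun x => u x * rieszProduct Λ z x) 1) (ft u 1),
      norm_ft_mul_one_add_re_sub_le (hz γ) h₁ h₂]

lemma sum_mul_rieszProduct_le_two {β : G → ℝ} {n : ℕ} {Λ : Finset (AddChar G ℂ)}
    (hβ : ∑ x, β x = 1) (hΛ : DissociatedRel β n Λ) (hcard : Λ.card ≤ n)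
    {z : AddChar G ℂ → ℂ} (hz : ∀ γ, ‖z γ‖ ≤ 1) :
    ∑ x, β x * rieszProduct Λ z x ≤ 2 := by
  have hft_one (u : G → ℝ) : ft u 1 = ((∑ x, u x : ℝ) : ℂ) := by simp [ft]
  have h := norm_ft_mul_rieszProduct_sub_le hz Λ hΛ
  rw [hft_one, hft_one, hβ, ← Complex.ofReal_sub, Complex.norm_real] at h
  have hpow : ((2 : ℝ) ^ Λ.card - 1) * (2 ^ n)⁻¹ ≤ 1 := by
    rw [mul_inv_le_iff₀ (by positivity), one_mul]
    linarith [pow_le_pow_right₀ (one_le_two (α := ℝ)) hcard]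
  linarith [Real.le_norm_self (∑ x, β x * rieszProduct Λ z x - 1)]

end RieszProducts

section SpectrumControl

lemma exp_half_le {y : ℝ} (hy : |y| ≤ 1) :
    Real.exp (y / 2) ≤ Real.exp (1 / 8) * (1 + Real.tanh (1 / 2) * y) := by
  obtain ⟨hy₁, hy₂⟩ := abs_le.1 hy
  have hcosh_pos := Real.cosh_pos (1 / 2)
  have hconvex : Real.exp (y / 2) ≤ Real.cosh (1 / 2) + Real.sinh (1 / 2) * y := by
    have h := convexOn_exp.2 (Set.mem_univ (-(1 / 2))) (Set.mem_univ (1 / 2))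
      (by linarith : 0 ≤ (1 - y) / 2) (by linarith : 0 ≤ (1 + y) / 2) (by ring)
    simp only [smul_eq_mul] at h
    rw [Real.cosh_eq, Real.sinh_eq]
    calc Real.exp (y / 2) = Real.exp ((1 - y) / 2 * -(1 / 2) + (1 + y) / 2 * (1 / 2)) := by ring_nf
      _ ≤ _ := h
      _ = _ := by ring
  have hfactor : Real.cosh (1 / 2) + Real.sinh (1 / 2) * y
      = Real.cosh (1 / 2) * (1 + Real.tanh (1 / 2) * y) := by
    rw [Real.tanh_eq_sinh_div_cosh]
    field_simp
  have hcosh : Real.cosh (1 / 2) ≤ Real.exp (1 / 8) :=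
    (Real.cosh_le_exp_half_sq _).trans_eq (by norm_num)
  rw [hfactor] at hconvex
  exact hconvex.trans (mul_le_mul_of_nonneg_right hcosh
    (pos_of_mul_pos_right ((Real.exp_pos _).trans_le hconvex) hcosh_pos.le).le)

variable {G : Type*} [AddCommGroup G]

lemma exp_half_sum_re_le_rieszProduct [Finite G] {ω : AddChar G ℂ → ℂ} (hω : ∀ γ, ‖ω γ‖ ≤ 1)
    (Λ : Finset (AddChar G ℂ)) (x : G) :
    Real.exp ((∑ γ ∈ Λ, (ω γ * γ x).re) / 2)
      ≤ Real.exp (1 / 8) ^ Λ.card * rieszProduct Λ (fun γ => Real.tanh (1 / 2) * ω γ) x := by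
  have habs (γ : AddChar G ℂ) : |(ω γ * γ x).re| ≤ 1 := by
    refine (Complex.abs_re_le_norm _).trans ?_
    rw [norm_mul, AddChar.norm_apply, mul_one]
    exact hω γ
  rw [rieszProduct, Finset.sum_div, Real.exp_sum, ← Finset.prod_const, ← Finset.prod_mul_distrib]
  refine Finset.prod_le_prod (fun _ _ => (Real.exp_pos _).le) fun γ _ => ?_
  rw [mul_assoc, Complex.re_ofReal_mul]
  exact exp_half_le (habs γ)

lemma norm_char_mul_sub_one_le [Finite G] (γ χ : AddChar G ℂ) (t : G) :
    ‖(γ * χ) t - 1‖ ≤ ‖γ t - 1‖ + ‖χ t - 1‖ := by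
  have h : (γ * χ) t - 1 = γ t * (χ t - 1) + (γ t - 1) := by
    rw [AddChar.mul_apply]
    ring
  rw [h, add_comm ‖γ t - 1‖]
  refine (norm_add_le _ _).trans_eq ?_
  rw [norm_mul, AddChar.norm_apply, one_mul]

lemma norm_char_zpow_sign_sub_one_le [Finite G] (γ : AddChar G ℂ)
    (s : SignType) (t : G) : ‖(γ ^ (s : ℤ)) t - 1‖ ≤ ‖γ t - 1‖ := by
  cases s with
  | zero => simp
  | neg => exact le_of_eq (by simpa [AddChar.inv_apply] using norm_char_neg_sub_one γ t)
  | pos => simp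

lemma norm_prod_char_zpow_sign_sub_one_le [Finite G]
    (Λ : Finset (AddChar G ℂ)) (e : AddChar G ℂ → SignType) (t : G) :
    ‖(∏ χ ∈ Λ, χ ^ (e χ : ℤ)) t - 1‖ ≤ ∑ χ ∈ Λ, ‖χ t - 1‖ := by
  classical
  induction Λ using Finset.induction_on with
  | empty => simp
  | insert χ Λ hχ ih =>
    rw [Finset.prod_insert hχ, Finset.sum_insert hχ]
    exact (norm_char_mul_sub_one_le _ _ t).trans
      (add_le_add (norm_char_zpow_sign_sub_one_le χ _ t) ih)

lemma norm_char_sub_one_le_of_zpow_sign_mul [Finite G]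
    (γ ψ : AddChar G ℂ) {s : SignType} (hs : s ≠ 0) (t : G) :
    ‖γ t - 1‖ ≤ ‖(γ ^ (s : ℤ) * ψ) t - 1‖ + ‖ψ t - 1‖ := by
  have hγ : γ = ((γ ^ (s : ℤ) * ψ) * ψ⁻¹) ^ (s : ℤ) := by
    rw [mul_inv_cancel_right]
    cases s <;> simp_all
  have hψ : ‖ψ⁻¹ t - 1‖ = ‖ψ t - 1‖ := by rw [AddChar.inv_apply, norm_char_neg_sub_one]
  calc ‖γ t - 1‖ ≤ ‖(γ ^ (s : ℤ) * ψ * ψ⁻¹) t - 1‖ := by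
        conv_lhs => rw [hγ]
        exact norm_char_zpow_sign_sub_one_le _ s t
    _ ≤ _ := (norm_char_mul_sub_one_le _ _ t).trans_eq (by rw [hψ])

variable [Fintype G]

lemma card_div_two_le_sum_mul_sum_re {w : G → ℝ} {ω : AddChar G ℂ → ℂ} {Λ : Finset (AddChar G ℂ)}
    (h : ∀ γ ∈ Λ, 1 / 2 ≤ (ω γ * ft w γ).re) :
    (Λ.card : ℝ) / 2 ≤ ∑ x, w x * ∑ γ ∈ Λ, (ω γ * γ x).re := by
  have hre (γ : AddChar G ℂ) : (ω γ * ft w γ).re = ∑ x, w x * (ω γ * γ x).re := by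
    rw [ft, Finset.mul_sum, Complex.re_sum]
    exact Finset.sum_congr rfl fun x _ => by rw [mul_left_comm, Complex.re_ofReal_mul]
  calc (Λ.card : ℝ) / 2 = ∑ γ ∈ Λ, (1 / 2 : ℝ) := by
        rw [Finset.sum_const, nsmul_eq_mul, mul_one_div]
    _ ≤ ∑ γ ∈ Λ, (ω γ * ft w γ).re := Finset.sum_le_sum h
    _ = ∑ x, w x * ∑ γ ∈ Λ, (ω γ * γ x).re := by
        simp_rw [hre, Finset.mul_sum]
        exact Finset.sum_comm

lemma card_le_of_dissociatedRel {β w : G → ℝ} {n : ℕ} {Λ : Finset (AddChar G ℂ)} {D : ℝ}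
    (hβ : ∀ x, 0 ≤ β x) (hβ_sum : ∑ x, β x = 1) (hw : ∀ x, 0 ≤ w x) (hw_sum : ∑ x, w x = 1)
    (hwβ : ∀ x, w x ≤ D * β x) (hΛ : DissociatedRel β n Λ) (hcard : Λ.card ≤ n)
    (hspec : ∀ γ ∈ Λ, 1 / 2 ≤ ‖ft w γ‖) :
    (Λ.card : ℝ) ≤ 8 * Real.log (2 * D) := by
  choose ω hω_norm hω using fun γ => RCLike.exists_norm_eq_mul_self (ft w γ)
  set Y : G → ℝ := fun x => ∑ γ ∈ Λ, (ω γ * γ x).re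
  set z : AddChar G ℂ → ℂ := fun γ => Real.tanh (1 / 2) * ω γ
  have hz (γ : AddChar G ℂ) : ‖z γ‖ ≤ 1 := by
    rw [norm_mul, hω_norm, mul_one, Complex.norm_real]
    exact (Real.abs_tanh_lt_one _).le
  have hD : 1 ≤ D := by
    simpa only [hw_sum, ← Finset.mul_sum, hβ_sum, mul_one] using
      Finset.sum_le_sum fun x (_ : x ∈ Finset.univ) => hwβ x
  have hmean : (Λ.card : ℝ) / 4 ≤ ∑ x, w x * (Y x / 2) := by
    have h : (Λ.card : ℝ) / 2 ≤ ∑ x, w x * Y x := card_div_two_le_sum_mul_sum_re fun γ hγ => by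
      rw [← hω]
      exact hspec γ hγ
    simp_rw [← mul_div_assoc, ← Finset.sum_div]
    linarith
  have hexp : Real.exp (Λ.card / 4) ≤ 2 * D * Real.exp (Λ.card * (1 / 8)) :=
    calc Real.exp (Λ.card / 4) ≤ Real.exp (∑ x, w x * (Y x / 2)) := Real.exp_le_exp.2 hmean
      _ ≤ ∑ x, w x * Real.exp (Y x / 2) :=
          convexOn_exp.map_sum_le (fun x _ => hw x) hw_sum fun _ _ => Set.mem_univ _
      _ ≤ ∑ x, D * β x * (Real.exp (1 / 8) ^ Λ.card * rieszProduct Λ z x) :=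
          Finset.sum_le_sum fun x _ => mul_le_mul (hwβ x)
            (exp_half_sum_re_le_rieszProduct (fun γ => (hω_norm γ).le) Λ x) (Real.exp_pos _).le
            (mul_nonneg (by linarith) (hβ x))
      _ = D * Real.exp (Λ.card * (1 / 8)) * ∑ x, β x * rieszProduct Λ z x := by
          rw [Real.exp_nat_mul, Finset.mul_sum]
          exact Finset.sum_congr rfl fun x _ => by ring
      _ ≤ D * Real.exp (Λ.card * (1 / 8)) * 2 := by
          gcongr
          exact sum_mul_rieszProduct_le_two hβ_sum hΛ hcard hz
      _ = _ := by ring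
  have hlog := Real.log_le_log (Real.exp_pos _) hexp
  rw [Real.log_mul (by positivity) (Real.exp_pos _).ne', Real.log_exp, Real.log_exp] at hlog
  linarith

/-- `Λ` is a maximal dissociated subset of the large spectrum of `w`. -/
lemma exists_spectrum_control {β w : G → ℝ} {n : ℕ} {D : ℝ} (hβ : ∀ x, 0 ≤ β x)
    (hβ_sum : ∑ x, β x = 1) (hw : ∀ x, 0 ≤ w x) (hw_sum : ∑ x, w x = 1)
    (hwβ : ∀ x, w x ≤ D * β x) (hn : 8 * Real.log (2 * D) < n) :
    ∃ Λ : Finset (AddChar G ℂ), Λ.card ≤ n ∧ ∀ (t : G) (a b : ℝ), 0 ≤ a → 0 ≤ b →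
      (∀ χ : AddChar G ℂ, (2 ^ n)⁻¹ < ‖ft β χ‖ → ‖χ t - 1‖ ≤ a) → (∀ γ ∈ Λ, ‖γ t - 1‖ ≤ b) →
      ∀ γ : AddChar G ℂ, 1 / 2 ≤ ‖ft w γ‖ → ‖γ t - 1‖ ≤ a + n * b := by
  classical
  obtain ⟨Λ, ⟨hspec, hdiss, hcard⟩, hmax⟩ :=
    (Set.toFinite {Λ : Finset (AddChar G ℂ) | (∀ γ ∈ Λ, 1 / 2 ≤ ‖ft w γ‖) ∧
      DissociatedRel β n Λ ∧ Λ.card ≤ n}).exists_maximal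
      ⟨∅, by simp, fun e ⟨γ, hγ, _⟩ => absurd hγ (Finset.notMem_empty γ), Nat.zero_le n⟩
  have hlt : Λ.card < n := by
    exact_mod_cast (card_le_of_dissociatedRel hβ hβ_sum hw hw_sum hwβ hdiss hcard hspec).trans_lt hn
  refine ⟨Λ, hcard, fun t a b ha hb hχ hΛb γ hγ => ?_⟩
  have hsum : ∑ χ ∈ Λ, ‖χ t - 1‖ ≤ n * b :=
    calc ∑ χ ∈ Λ, ‖χ t - 1‖ ≤ Λ.card * b := by
          simpa only [nsmul_eq_mul] using Finset.sum_le_card_nsmul Λ _ b hΛb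
      _ ≤ n * b := by gcongr
  by_cases hmem : γ ∈ Λ
  · exact (Finset.single_le_sum (f := fun χ : AddChar G ℂ => ‖χ t - 1‖)
      (fun _ _ => norm_nonneg _) hmem).trans (by linarith)
  obtain ⟨e, hne, hbig⟩ : ∃ e : AddChar G ℂ → SignType, (∃ χ ∈ insert γ Λ, e χ ≠ 0) ∧
      (2 ^ n)⁻¹ < ‖ft β (∏ χ ∈ insert γ Λ, χ ^ (e χ : ℤ))‖ := by
    by_contra! hdiss'
    refine hmem (hmax ⟨?_, hdiss', ?_⟩ (Finset.subset_insert γ Λ) (Finset.mem_insert_self γ Λ))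
    · exact Finset.forall_mem_insert _ _ _ |>.2 ⟨hγ, hspec⟩
    · rw [Finset.card_insert_of_notMem hmem]
      omega
  have hγ₀ : e γ ≠ 0 := fun h₀ => by
    obtain ⟨χ, hχmem, hχ₀⟩ := hne
    rw [Finset.prod_insert hmem, h₀, SignType.coe_zero, zpow_zero, one_mul] at hbig
    refine hbig.not_ge (hdiss e ⟨χ, ?_, hχ₀⟩)
    exact (Finset.mem_insert.1 hχmem).resolve_left fun h => hχ₀ (h ▸ h₀)
  rw [Finset.prod_insert hmem] at hbig
  exact (norm_char_sub_one_le_of_zpow_sign_mul γ _ hγ₀ t).trans (add_le_add (hχ _ hbig)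
    ((norm_prod_char_zpow_sign_sub_one_le Λ e t).trans hsum))

end SpectrumControl

section IteratedAverages

variable {G : Type*} [AddCommGroup G] [Fintype G]

lemma sum_conv (u w : G → ℝ) : ∑ x, conv u w x = (∑ x, u x) * ∑ x, w x := by
  simp only [conv]
  rw [Finset.sum_comm, Finset.sum_mul]
  refine Finset.sum_congr rfl fun y _ => ?_
  rw [← Finset.mul_sum]
  exact congrArg (u y * ·) (Equiv.sum_comp (Equiv.subRight y) w)

lemma ft_iterate_conv (w u : G → ℝ) (n : ℕ) (γ : AddChar G ℂ) :
    ft ((conv w)^[n] u) γ = ft w γ ^ n * ft u γ := by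
  induction n with
  | zero => simp
  | succ n ih => rw [Function.iterate_succ_apply', ft_conv, ih, pow_succ', mul_assoc]

variable [DecidableEq G]

lemma conv_unif_apply (X : Finset G) (u : G → ℝ) (x : G) :
    conv (unif X) u x = (∑ y ∈ X, u (x - y)) / X.card :=
  sum_unif_mul X fun y => u (x - y)

lemma conv_unif_nonneg (X : Finset G) {u : G → ℝ} (hu : ∀ x, 0 ≤ u x) (x : G) :
    0 ≤ conv (unif X) u x :=
  Finset.sum_nonneg fun _ _ => mul_nonneg (unif_nonneg _ _) (hu _)

lemma iterate_conv_unif_nonneg (X : Finset G) {u : G → ℝ} (hu : ∀ x, 0 ≤ u x) (n : ℕ) (x : G) :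
    0 ≤ (conv (unif X))^[n] u x := by
  induction n generalizing x with
  | zero => exact hu x
  | succ n ih =>
    rw [Function.iterate_succ_apply']
    exact conv_unif_nonneg X ih x

lemma sum_iterate_conv_unif {X : Finset G} (hX : X.Nonempty) (u : G → ℝ) (n : ℕ) :
    ∑ x, (conv (unif X))^[n] u x = ∑ x, u x := by
  induction n with
  | zero => rfl
  | succ n ih => rw [Function.iterate_succ_apply', sum_conv, sum_unif hX, ih, one_mul]

lemma iterate_conv_unif_bohr {Γ : Finset (AddChar G ℂ)} {σ s : ℝ} (hσ : 0 ≤ σ) (n : ℕ) {x : G}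
    (hx : x ∈ bohr Γ (s - n * σ)) :
    (conv (unif (bohrFin Γ σ)))^[n] (unif (bohrFin Γ s)) x = 1 / (bohrFin Γ s).card := by
  induction n generalizing x with
  | zero =>
    have hmem : x ∈ bohrFin Γ s := by simpa using hx
    simp [unif, ind, hmem]
  | succ n ih =>
    have hcard : ((bohrFin Γ σ).card : ℝ) ≠ 0 :=
      Nat.cast_ne_zero.2 (bohrFin_nonempty Γ hσ).card_pos.ne'
    rw [Function.iterate_succ_apply', conv_unif_apply, Finset.sum_congr rfl fun y hy => ih ?_,
      Finset.sum_const, nsmul_eq_mul, mul_div_cancel_left₀ _ hcard]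
    have hxy := add_mem_bohr hx (neg_mem_bohr (mem_bohrFin.1 hy))
    rw [← sub_eq_add_neg] at hxy
    refine bohr_mono Γ (le_of_eq ?_) hxy
    push_cast
    ring

end IteratedAverages

section ChangBohr

variable {G : Type*} [AddCommGroup G]

lemma BohrSet.IsRegular.ncard_dilate_le_two_mul [Finite G] {B : BohrSet G} (hB : B.IsRegular)
    (hrank : 1 ≤ B.rank) :
    ((B.dilate (1 + 1 / (12 * B.rank))).ncard : ℝ) ≤ 2 * B.carrier.ncard := by
  have : (1 : ℝ) ≤ B.rank := by exact_mod_cast hrank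
  have hcard : (0 : ℝ) < B.carrier.ncard := by exact_mod_cast ncard_bohr_pos _ B.radius_nonneg
  have hτ : 12 * (B.rank : ℝ) * |1 / (12 * B.rank : ℝ)| = 1 := by
    rw [abs_of_nonneg (by positivity)]
    field_simp
  have h := (hB _ hτ.le).2
  rw [hτ, div_le_iff₀ hcard] at h
  linarith

variable [Fintype G]

lemma norm_char_sub_one_mul_norm_ft_le (u : G → ℝ) (χ : AddChar G ℂ) (t : G) :
    ‖χ t - 1‖ * ‖ft u χ‖ ≤ ∑ x, |u (x + -t) - u x| := by
  have h : (χ t - 1) * ft u χ = ∑ x, ((u (x + -t) - u x : ℝ) : ℂ) * χ x := by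
    have hshift := ft_shift u (-t) χ
    rw [neg_neg] at hshift
    rw [sub_mul, ← hshift, one_mul, ft, ft, ← Finset.sum_sub_distrib]
    refine Finset.sum_congr rfl fun x _ => ?_
    push_cast
    ring
  rw [← norm_mul, h]
  refine (norm_sum_le _ _).trans_eq (Finset.sum_congr rfl fun x _ => ?_)
  rw [norm_mul, AddChar.norm_apply, mul_one, Complex.norm_real, Real.norm_eq_abs]

lemma sum_abs_unif_bohrFin_shift_sub_le [DecidableEq G] {X : BohrSet G} (hX : X.IsRegular) {τ : ℝ}
    (hτ : 0 ≤ τ) (hτ_small : 12 * (X.rank : ℝ) * τ ≤ 1) {t : G} (ht : t ∈ X.dilate τ) :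
    ∑ x, |unif (bohrFin X.freqs X.radius) (x + -t) - unif (bohrFin X.freqs X.radius) x|
      ≤ 24 * X.rank * τ := by
  set F := bohrFin X.freqs X.radius
  set F' := bohrFin X.freqs ((1 - τ) * X.radius)
  have hF : F.Nonempty := bohrFin_nonempty _ X.radius_nonneg
  have hreg : 1 - 12 * (X.rank : ℝ) * τ ≤ F'.card / F.card := by
    have h := (hX (-τ) (by rwa [abs_neg, abs_of_nonneg hτ])).1
    rw [abs_neg, abs_of_nonneg hτ, ← sub_eq_add_neg] at h
    rwa [card_bohrFin, card_bohrFin]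
  have hF' (x : G) (hx : x ∈ F') : x ∈ F ∧ x + -t ∈ F := by
    have hx' := mem_bohrFin.1 hx
    have hr := mul_nonneg hτ X.radius_nonneg
    exact ⟨mem_bohrFin.2 (bohr_mono _ (by linarith) hx'),
      mem_bohrFin.2 (bohr_mono _ (le_of_eq (by ring)) (add_mem_bohr hx' (neg_mem_bohr ht)))⟩
  have hpointwise (x : G) :
      |unif F (x + -t) - unif F x| ≤ unif F (x + -t) + unif F x - 2 * (ind F' x / F.card) := by
    by_cases hx : x ∈ F'
    · simp only [unif, ind, if_pos hx, if_pos (hF' x hx).1, if_pos (hF' x hx).2, sub_self, abs_zero]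
      exact le_of_eq (by ring)
    · have h₁ := unif_nonneg F (x + -t)
      have h₂ := unif_nonneg F x
      simp only [ind, if_neg hx, zero_div, mul_zero, sub_zero]
      exact abs_le.2 ⟨by linarith, by linarith⟩
  calc ∑ x, |unif F (x + -t) - unif F x|
      ≤ ∑ x, (unif F (x + -t) + unif F x - 2 * (ind F' x / F.card)) :=
        Finset.sum_le_sum fun x _ => hpointwise x
    _ = 2 - 2 * (F'.card / F.card) := by
        have hshift : ∑ x, unif F (x + -t) = ∑ x, unif F x :=
          Equiv.sum_comp (Equiv.addRight (-t)) (unif F)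
        rw [Finset.sum_sub_distrib, Finset.sum_add_distrib, hshift, sum_unif hF, ← Finset.mul_sum,
          ← Finset.sum_div]
        simp only [ind, Finset.sum_boole, Finset.filter_mem_eq_inter, Finset.univ_inter]
        ring
    _ ≤ 24 * X.rank * τ := by linarith

lemma norm_char_sub_one_le_of_half_le [DecidableEq G] {X : BohrSet G} (hX : X.IsRegular)
    {χ : AddChar G ℂ} (hχ : 1 / 2 ≤ ‖ft (unif (bohrFin X.freqs X.radius)) χ‖) {τ : ℝ} (hτ : 0 ≤ τ)
    (hτ_small : 12 * (X.rank : ℝ) * τ ≤ 1) {t : G} (ht : t ∈ X.dilate τ) :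
    ‖χ t - 1‖ ≤ 48 * X.rank * τ := by
  have h := (norm_char_sub_one_mul_norm_ft_le _ χ t).trans
    (sum_abs_unif_bohrFin_shift_sub_le hX hτ hτ_small ht)
  linarith [mul_le_mul_of_nonneg_left hχ (norm_nonneg (χ t - 1))]

/-- The weight is an `n`-fold average, over a narrow regular Bohr set, of the uniform weight on a
slight dilate of `B`. In `2359296 = 48 * 12 * 4096` the last factor is the loss incurred in choosing
a regular radius. -/
lemma exists_bohr_majorant {B : BohrSet G} (hB : B.IsRegular) (hrank : 1 ≤ B.rank) {n : ℕ}
    (hn : 1 ≤ n) :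
    ∃ β : G → ℝ, (∀ x, 0 ≤ β x) ∧ ∑ x, β x = 1 ∧
      (∀ x ∈ B.carrier, 1 / (2 * B.carrier.ncard) ≤ β x) ∧
      ∀ χ : AddChar G ℂ, (2 ^ n)⁻¹ < ‖ft β χ‖ → ∀ κ, 0 ≤ κ → κ ≤ 1 →
        ∀ t ∈ bohr B.freqs (B.radius * κ / (2359296 * B.rank ^ 2 * n)), ‖χ t - 1‖ ≤ κ := by
  classical
  set d : ℝ := (B.rank : ℝ)
  set ρ := B.radius
  have hd : 1 ≤ d := Nat.one_le_cast.2 hrank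
  have : (1 : ℝ) ≤ n := Nat.one_le_cast.2 hn
  have hρ : 0 ≤ ρ := B.radius_nonneg
  obtain ⟨X, hXf, hX₁, hX₂, hXreg⟩ := exists_regular_dilate (Γ := B.freqs)
    (Finset.card_pos.1 hrank) (ρ := ρ / (12 * d * n)) (by positivity)
  have hXrank : (X.rank : ℝ) = d := by rw [BohrSet.rank, hXf, ← BohrSet.rank]
  set s := (1 + 1 / (12 * d)) * ρ
  have hs : 0 ≤ s := by positivity
  set F := bohrFin B.freqs X.radius
  set S := bohrFin B.freqs s
  refine ⟨(conv (unif F))^[n] (unif S), iterate_conv_unif_nonneg F (unif_nonneg S) n, ?_,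
    fun x hx => ?_, fun χ hχ κ hκ₀ hκ₁ t ht => ?_⟩
  · rw [sum_iterate_conv_unif (bohrFin_nonempty _ X.radius_nonneg),
      sum_unif (bohrFin_nonempty _ hs)]
  · have hnX : ρ ≤ s - n * X.radius := by
      have hnX₁ : n * X.radius ≤ n * (ρ / (12 * d * n)) := by gcongr
      have hnX₂ : n * (ρ / (12 * d * n)) = 1 / (12 * d) * ρ := by field_simp
      linarith
    rw [iterate_conv_unif_bohr X.radius_nonneg n (bohr_mono _ hnX hx)]
    refine one_div_le_one_div_of_le (by exact_mod_cast (bohrFin_nonempty _ hs).card_pos) ?_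
    rw [card_bohrFin]
    exact hB.ncard_dilate_le_two_mul hrank
  · rw [ft_iterate_conv, norm_mul, norm_pow] at hχ
    have hhalf : 1 / 2 ≤ ‖ft (unif F) χ‖ := by
      by_contra! hlt
      refine hχ.not_ge ?_
      rw [← inv_pow, ← one_div, ← mul_one ((1 / 2 : ℝ) ^ n)]
      exact mul_le_mul (pow_le_pow_left₀ (norm_nonneg _) hlt.le n) (norm_ft_unif_le_one _ χ)
        (norm_nonneg _) (by positivity)
    have hτ : 12 * d * (κ / (48 * d)) = κ / 4 := by field_simp; ring
    have h := norm_char_sub_one_le_of_half_le hXreg (by rwa [hXf]) (τ := κ / (48 * d))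
      (by positivity) (by rw [hXrank]; linarith) (t := t) ?_
    · exact h.trans_eq (by rw [hXrank]; field_simp)
    · rw [BohrSet.dilate, hXf]
      refine bohr_mono _ ?_ ht
      calc ρ * κ / (2359296 * d ^ 2 * n) = κ / (48 * d) * (ρ / (12 * d * n) / 4096) := by
            field_simp
            ring
        _ ≤ κ / (48 * d) * X.radius := by gcongr

theorem chang_bohr [DecidableEq G] {B : BohrSet G} (hB : B.IsRegular) (hrank : 1 ≤ B.rank)
    (hrad : B.radius ≤ 2) {T : Finset G} (hT : T.Nonempty) (hTB : (T : Set G) ⊆ B.carrier)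
    {κ : ℝ} (hκ₀ : 0 ≤ κ) (hκ₁ : κ ≤ 1) {n : ℕ}
    (hn : 8 * Real.log (4 * (B.carrier.ncard / T.card)) < n) :
    ∃ Λ : Finset (AddChar G ℂ), Λ.card ≤ n ∧
      ∀ t ∈ bohr B.freqs (B.radius * κ / (4718592 * B.rank ^ 2 * n)),
        t ∈ bohr Λ (B.radius * κ / (4718592 * B.rank ^ 2 * n)) →
        ∀ γ : AddChar G ℂ, 1 / 2 ≤ ‖ft (unif T) γ‖ → ‖γ t - 1‖ ≤ κ := by
  set d : ℝ := (B.rank : ℝ)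
  have hd : 1 ≤ d := Nat.one_le_cast.2 hrank
  have hT_card : (0 : ℝ) < T.card := by exact_mod_cast hT.card_pos
  have hB_card : (0 : ℝ) < B.carrier.ncard := by exact_mod_cast ncard_bohr_pos _ B.radius_nonneg
  have hTB_card : (T.card : ℝ) ≤ B.carrier.ncard := by
    exact_mod_cast (Set.ncard_coe_finset T).symm.trans_le (Set.ncard_le_ncard hTB (Set.toFinite _))
  have hn_pos : (0 : ℝ) < n := by
    refine lt_of_le_of_lt (mul_nonneg (by norm_num) (Real.log_nonneg ?_)) hn
    linarith [(one_le_div hT_card).2 hTB_card]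
  obtain ⟨β, hβ, hβ_sum, hβB, hβ_spec⟩ := exists_bohr_majorant hB hrank (Nat.cast_pos.1 hn_pos)
  have hTβ (x : G) : unif T x ≤ 2 * (B.carrier.ncard / T.card) * β x := by
    by_cases hx : x ∈ T
    · calc unif T x = 2 * (B.carrier.ncard / T.card) * (1 / (2 * B.carrier.ncard)) := by
            rw [unif, ind, if_pos hx]
            field_simp
        _ ≤ _ := by
            gcongr
            exact hβB x (hTB hx)
    · rw [unif, ind, if_neg hx, zero_div]
      exact mul_nonneg (by positivity) (hβ x)
  obtain ⟨Λ, hΛ, hcontrol⟩ := exists_spectrum_control hβ hβ_sum (unif_nonneg T) (sum_unif hT) hTβ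
    (n := n) (by rwa [← mul_assoc, show (2 : ℝ) * 2 = 4 by norm_num])
  refine ⟨Λ, hΛ, fun t htB htΛ γ hγ => ?_⟩
  have hr : 0 ≤ B.radius * κ := mul_nonneg B.radius_nonneg hκ₀
  have h := hcontrol t (κ / 2) _ (by linarith) (by positivity)
    (fun χ hχ => hβ_spec χ hχ (κ / 2) (by linarith) (by linarith) t
      (bohr_mono _ (le_of_eq (by ring)) htB)) htΛ γ hγ
  have hsmall : n * (B.radius * κ / (4718592 * d ^ 2 * n)) ≤ κ / 2 := by
    have hcancel : n * (B.radius * κ / (4718592 * d ^ 2 * n))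
        = B.radius * κ / (4718592 * d ^ 2) := by
      field_simp
    rw [hcancel, div_le_iff₀ (by positivity)]
    nlinarith [mul_le_mul_of_nonneg_right hrad hκ₀, one_le_pow₀ hd (n := 2)]
  linarith

end ChangBohr

section Moments

lemma div_rpow_le_sinh_two_mul {u m : ℝ} (hu : 0 ≤ u) (hm : 1 ≤ m) :
    (u / m) ^ m ≤ Real.sinh (2 * u) := by
  rcases hu.eq_or_lt with rfl | hu_pos
  · simp [Real.zero_rpow (by linarith : m ≠ 0)]
  have hdiv : u / m ≤ u := div_le_self hu hm
  have hexp : (u / m) ^ (m - 1) ≤ Real.exp u :=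
    calc (u / m) ^ (m - 1) ≤ Real.exp (u / m) ^ (m - 1) :=
          Real.rpow_le_rpow (by positivity) (by linarith [Real.add_one_le_exp (u / m)])
            (by linarith)
      _ = Real.exp (u - u / m) := by
          rw [← Real.exp_mul]
          congr 1
          field_simp
      _ ≤ Real.exp u := Real.exp_le_exp.2 (sub_le_self u (by positivity))
  have hcosh : Real.exp u ≤ 2 * Real.cosh u := by
    rw [Real.cosh_eq]
    linarith [Real.exp_pos (-u)]
  calc (u / m) ^ m = u / m * (u / m) ^ (m - 1) := by
        rw [Real.rpow_sub_one (by positivity)]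
        field_simp
    _ ≤ u * Real.exp u := by gcongr
    _ ≤ Real.sinh u * (2 * Real.cosh u) := by
        gcongr
        exact Real.self_le_sinh_iff.2 hu
    _ = Real.sinh (2 * u) := by rw [Real.sinh_two_mul]; ring

lemma abs_rpow_two_mul_le_cosh {m : ℝ} (hm : 1 ≤ m) (z : ℝ) :
    |z| ^ (2 * m) ≤ (16 * m ^ 2) ^ m * (Real.cosh z - 1) := by
  have hsinh : (|z| / 4 / m) ^ m ≤ Real.sinh (|z| / 2) := by
    convert div_rpow_le_sinh_two_mul (by positivity : 0 ≤ |z| / 4) hm using 2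
    ring
  have hcosh : Real.cosh z - 1 = 2 * Real.sinh (|z| / 2) ^ 2 := by
    have h := Real.cosh_two_mul (|z| / 2)
    rw [mul_div_cancel₀ _ two_ne_zero, Real.cosh_abs, Real.cosh_sq] at h
    linarith
  calc |z| ^ (2 * m) = (16 * m ^ 2 * (|z| / 4 / m) ^ 2) ^ m := by
        rw [Real.rpow_mul (abs_nonneg z), Real.rpow_two]
        congr 1
        field_simp
        ring
    _ = (16 * m ^ 2) ^ m * ((|z| / 4 / m) ^ m) ^ 2 := by
        rw [Real.mul_rpow (by positivity) (by positivity), ← Real.rpow_natCast_mul (by positivity),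
          mul_comm (_ : ℝ) m, Real.rpow_mul_natCast (by positivity)]
    _ ≤ (16 * m ^ 2) ^ m * Real.sinh (|z| / 2) ^ 2 := by gcongr
    _ ≤ (16 * m ^ 2) ^ m * (Real.cosh z - 1) := by
        gcongr
        linarith [sq_nonneg (Real.sinh (|z| / 2))]

variable {α : Type*} {A : Finset α} {y : α → ℝ} {v m : ℝ} {n : ℕ}

lemma sum_exp_sum_le {l : ℝ} (hy_sum : ∑ a ∈ A, y a = 0) (hy_abs : ∀ a ∈ A, |y a| ≤ 1)
    (hy_sq : ∑ a ∈ A, y a ^ 2 ≤ A.card * v) (hl : |l| ≤ 1) :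
    ∑ a ∈ Fintype.piFinset fun _ : Fin n => A, Real.exp (l * ∑ i, y (a i))
      ≤ A.card ^ n * Real.exp (n * v * l ^ 2) := by
  have hsingle : ∑ a ∈ A, Real.exp (l * y a) ≤ A.card * Real.exp (v * l ^ 2) :=
    calc ∑ a ∈ A, Real.exp (l * y a) ≤ ∑ a ∈ A, (1 + l * y a + l ^ 2 * y a ^ 2) := by
          refine Finset.sum_le_sum fun a ha => ?_
          have hla : |l * y a| ≤ 1 := by
            rw [abs_mul]
            exact mul_le_one₀ hl (abs_nonneg _) (hy_abs a ha)
          linarith [(abs_le.1 (Real.abs_exp_sub_one_sub_id_le hla)).2, mul_pow l (y a) 2]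
      _ = A.card + l ^ 2 * ∑ a ∈ A, y a ^ 2 := by
          rw [Finset.sum_add_distrib, Finset.sum_add_distrib, ← Finset.mul_sum, ← Finset.mul_sum,
            hy_sum, Finset.sum_const, nsmul_eq_mul]
          ring
      _ ≤ A.card + l ^ 2 * (A.card * v) := by gcongr
      _ = A.card * (v * l ^ 2 + 1) := by ring
      _ ≤ _ := mul_le_mul_of_nonneg_left (Real.add_one_le_exp _) (Nat.cast_nonneg _)
  calc ∑ a ∈ Fintype.piFinset fun _ : Fin n => A, Real.exp (l * ∑ i, y (a i))
      = (∑ a ∈ A, Real.exp (l * y a)) ^ n := by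
        simp_rw [Finset.mul_sum, Real.exp_sum]
        rw [← Finset.prod_univ_sum (fun _ : Fin n => A) fun _ a => Real.exp (l * y a),
          Finset.prod_const, Finset.card_univ, Fintype.card_fin]
    _ ≤ (A.card * Real.exp (v * l ^ 2)) ^ n :=
        pow_le_pow_left₀ (Finset.sum_nonneg fun _ _ => (Real.exp_pos _).le) hsingle n
    _ = A.card ^ n * Real.exp (n * v * l ^ 2) := by
        rw [mul_pow, ← Real.exp_nat_mul, mul_assoc]

lemma sum_cosh_sum_le {l : ℝ} (hy_sum : ∑ a ∈ A, y a = 0) (hy_abs : ∀ a ∈ A, |y a| ≤ 1)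
    (hy_sq : ∑ a ∈ A, y a ^ 2 ≤ A.card * v) (hl : |l| ≤ 1) :
    ∑ a ∈ Fintype.piFinset fun _ : Fin n => A, (Real.cosh (l * ∑ i, y (a i)) - 1)
      ≤ A.card ^ n * (Real.exp (n * v * l ^ 2) - 1) := by
  have hpos := sum_exp_sum_le (n := n) hy_sum hy_abs hy_sq hl
  have hneg := sum_exp_sum_le (n := n) (l := -l) hy_sum hy_abs hy_sq (by rwa [abs_neg])
  simp_rw [Real.cosh_eq, ← neg_mul]
  rw [Finset.sum_sub_distrib, ← Finset.sum_div, Finset.sum_add_distrib]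
  simp only [Finset.sum_const, Fintype.card_piFinset, Finset.prod_const, Finset.card_univ,
    Fintype.card_fin, nsmul_eq_mul, mul_one]
  rw [neg_sq] at hneg
  push_cast
  linarith

lemma exp_le_three_rpow (hm : 0 ≤ m) : Real.exp m ≤ 3 ^ m := by
  rw [← Real.exp_one_rpow]
  exact Real.rpow_le_rpow (Real.exp_pos _).le (by linarith [Real.exp_one_lt_d9]) hm

lemma sum_abs_sum_rpow_le_of_le_variance (hm : 1 ≤ m) (hmv : m ≤ n * v)
    (hy_sum : ∑ a ∈ A, y a = 0) (hy_abs : ∀ a ∈ A, |y a| ≤ 1)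
    (hy_sq : ∑ a ∈ A, y a ^ 2 ≤ A.card * v) :
    ∑ a ∈ Fintype.piFinset fun _ : Fin n => A, |∑ i, y (a i)| ^ (2 * m)
      ≤ A.card ^ n * (48 * m * (n * v)) ^ m := by
  have hnv : 0 < n * v := by linarith
  set l := √(m / (n * v))
  have hl_pos : 0 < l := Real.sqrt_pos.2 (by positivity)
  have hl_sq : l ^ 2 = m / (n * v) := Real.sq_sqrt (by positivity)
  have hl_one : |l| ≤ 1 := by
    rw [abs_of_pos hl_pos]
    exact Real.sqrt_le_one.2 ((div_le_one hnv).2 hmv)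
  have hcosh := sum_cosh_sum_le (n := n) hy_sum hy_abs hy_sq hl_one
  rw [hl_sq, mul_div_cancel₀ _ hnv.ne'] at hcosh
  have hpointwise (z : ℝ) :
      |z| ^ (2 * m) ≤ (16 * m * (n * v)) ^ m * (Real.cosh (l * z) - 1) := by
    have h := abs_rpow_two_mul_le_cosh hm (l * z)
    have hsplit : (16 * m ^ 2) ^ m = (m / (n * v)) ^ m * (16 * m * (n * v)) ^ m := by
      rw [← Real.mul_rpow (by positivity) (by positivity)]
      congr 1
      rw [div_mul_eq_mul_div, eq_div_iff hnv.ne']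
      ring
    rw [abs_mul, abs_of_pos hl_pos, Real.mul_rpow hl_pos.le (abs_nonneg _),
      Real.rpow_mul hl_pos.le, Real.rpow_two, hl_sq, hsplit, mul_assoc] at h
    exact le_of_mul_le_mul_left h (by positivity)
  calc ∑ a ∈ Fintype.piFinset fun _ : Fin n => A, |∑ i, y (a i)| ^ (2 * m)
      ≤ (16 * m * (n * v)) ^ m *
          ∑ a ∈ Fintype.piFinset fun _ : Fin n => A, (Real.cosh (l * ∑ i, y (a i)) - 1) := by
        rw [Finset.mul_sum]
        exact Finset.sum_le_sum fun a _ => hpointwise _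
    _ ≤ (16 * m * (n * v)) ^ m * (A.card ^ n * 3 ^ m) := by
        refine mul_le_mul_of_nonneg_left (hcosh.trans ?_) (by positivity)
        gcongr
        linarith [exp_le_three_rpow (by linarith : 0 ≤ m)]
    _ = A.card ^ n * ((16 * m * (n * v)) ^ m * 3 ^ m) := by ring
    _ = A.card ^ n * (48 * m * (n * v)) ^ m := by
        rw [← Real.mul_rpow (by positivity) (by norm_num)]
        congr 2
        ring

lemma sum_abs_sum_rpow_le_of_variance_le (hm : 1 ≤ m) (hv : 0 ≤ v) (hmv : n * v ≤ m)
    (hy_sum : ∑ a ∈ A, y a = 0) (hy_abs : ∀ a ∈ A, |y a| ≤ 1)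
    (hy_sq : ∑ a ∈ A, y a ^ 2 ≤ A.card * v) :
    ∑ a ∈ Fintype.piFinset fun _ : Fin n => A, |∑ i, y (a i)| ^ (2 * m)
      ≤ A.card ^ n * ((48 * m ^ 2) ^ m * (n * v)) := by
  have hcosh := sum_cosh_sum_le (n := n) (l := 1) hy_sum hy_abs hy_sq (by rw [abs_one])
  simp only [one_mul, one_pow, mul_one] at hcosh
  have hexp : Real.exp (n * v) - 1 ≤ n * v * 3 ^ m := by
    have hone : 1 = Real.exp (n * v) * Real.exp (-(n * v)) := by
      rw [← Real.exp_add, add_neg_cancel, Real.exp_zero]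
    calc Real.exp (n * v) - 1 = Real.exp (n * v) * (1 - Real.exp (-(n * v))) := by linarith
      _ ≤ Real.exp (n * v) * (n * v) := by
          gcongr
          linarith [Real.add_one_le_exp (-(n * v))]
      _ ≤ 3 ^ m * (n * v) := by
          gcongr
          exact (Real.exp_le_exp.2 hmv).trans (exp_le_three_rpow (by linarith))
      _ = n * v * 3 ^ m := mul_comm _ _
  calc ∑ a ∈ Fintype.piFinset fun _ : Fin n => A, |∑ i, y (a i)| ^ (2 * m)
      ≤ (16 * m ^ 2) ^ m *
          ∑ a ∈ Fintype.piFinset fun _ : Fin n => A, (Real.cosh (∑ i, y (a i)) - 1) := by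
        rw [Finset.mul_sum]
        exact Finset.sum_le_sum fun a _ => abs_rpow_two_mul_le_cosh hm _
    _ ≤ (16 * m ^ 2) ^ m * (A.card ^ n * (n * v * 3 ^ m)) := by
        refine mul_le_mul_of_nonneg_left (hcosh.trans ?_) (by positivity)
        gcongr
    _ = A.card ^ n * ((16 * m ^ 2) ^ m * 3 ^ m * (n * v)) := by ring
    _ = A.card ^ n * ((48 * m ^ 2) ^ m * (n * v)) := by
        rw [← Real.mul_rpow (by positivity) (by norm_num)]
        congr 3
        ring

lemma sum_abs_sum_rpow_le (hm : 1 ≤ m) (hv : 0 ≤ v) (hy_sum : ∑ a ∈ A, y a = 0)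
    (hy_abs : ∀ a ∈ A, |y a| ≤ 1) (hy_sq : ∑ a ∈ A, y a ^ 2 ≤ A.card * v) :
    ∑ a ∈ Fintype.piFinset fun _ : Fin n => A, |∑ i, y (a i)| ^ (2 * m)
      ≤ A.card ^ n * ((48 * m * (n * v)) ^ m + (48 * m ^ 2) ^ m * (n * v)) := by
  rcases le_total m (n * v) with h | h
  · refine (sum_abs_sum_rpow_le_of_le_variance hm h hy_sum hy_abs hy_sq).trans ?_
    gcongr
    exact le_add_of_nonneg_right (by positivity)
  · refine (sum_abs_sum_rpow_le_of_variance_le hm hv h hy_sum hy_abs hy_sq).trans ?_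
    gcongr
    exact le_add_of_nonneg_left (by positivity)

lemma mul_sq_rpow_mul_le {q : ℝ} (hm : 1 ≤ m) (hq : 0 < q) :
    (48 * m ^ 2) ^ m * q ≤ (96 * m / q) ^ (2 * m - 1) * q ^ (2 * m) := by
  have hm_pos : 0 < m := by linarith
  have htwo : m ≤ 2 ^ m := by
    have h := one_add_mul_self_le_rpow_one_add (s := 1) (by norm_num) hm
    norm_num at h
    linarith
  have hconst : (48 : ℝ) ^ m * m ≤ 96 ^ (2 * m - 1) :=
    calc (48 : ℝ) ^ m * m ≤ 48 ^ m * 2 ^ m := by gcongr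
      _ = 96 ^ m := by
          rw [← Real.mul_rpow (by norm_num) (by norm_num)]
          norm_num
      _ ≤ 96 ^ (2 * m - 1) := Real.rpow_le_rpow_of_exponent_le (by norm_num) (by linarith)
  have hsq : (m ^ 2) ^ m = m ^ (2 * m - 1) * m := by
    rw [← Real.rpow_two, ← Real.rpow_mul hm_pos.le, Real.rpow_sub_one hm_pos.ne',
      div_mul_cancel₀ _ hm_pos.ne']
  calc (48 * m ^ 2) ^ m * q = 48 ^ m * m * (m ^ (2 * m - 1) * q) := by
        rw [Real.mul_rpow (by norm_num) (by positivity), hsq]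
        ring
    _ ≤ 96 ^ (2 * m - 1) * (m ^ (2 * m - 1) * q) := by gcongr
    _ = (96 * m / q) ^ (2 * m - 1) * q ^ (2 * m) := by
        rw [Real.div_rpow (by positivity) hq.le, Real.mul_rpow (by norm_num) hm_pos.le,
          Real.rpow_sub_one hq.ne']
        field_simp

/-- Rosenthal's inequality, for averages of `n` independent uniform samples from `A`. -/
lemma sum_abs_avg_rpow_le {θ : ℝ} (hm : 1 ≤ m) (hn : 96 * m ≤ n * θ ^ 2) (hv : 0 ≤ v)
    (hy_sum : ∑ a ∈ A, y a = 0) (hy_abs : ∀ a ∈ A, |y a| ≤ 1)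
    (hy_sq : ∑ a ∈ A, y a ^ 2 ≤ A.card * v) :
    ∑ a ∈ Fintype.piFinset fun _ : Fin n => A, |(∑ i, y (a i)) / n| ^ (2 * m)
      ≤ A.card ^ n * ((θ ^ 2) ^ m * v ^ m + (θ ^ 2) ^ (2 * m - 1) * v) := by
  have hn_pos : 0 < (n : ℝ) := by
    by_contra! h
    nlinarith [sq_nonneg θ]
  have hθ : 96 * m / n ≤ θ ^ 2 := by
    rw [div_le_iff₀ hn_pos]
    linarith
  have hgaussian : (48 * m * (n * v)) ^ m ≤ (θ ^ 2) ^ m * v ^ m * (n : ℝ) ^ (2 * m) := by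
    rw [Real.rpow_mul hn_pos.le, Real.rpow_two, ← Real.mul_rpow (by positivity) hv,
      ← Real.mul_rpow (by positivity) (by positivity)]
    refine Real.rpow_le_rpow (by positivity) ?_ (by linarith)
    calc 48 * m * (n * v) ≤ n * θ ^ 2 * (n * v) :=
          mul_le_mul_of_nonneg_right (by linarith) (by positivity)
      _ = θ ^ 2 * v * n ^ 2 := by ring
  have hpoisson : (48 * m ^ 2) ^ m * (n * v)
      ≤ (θ ^ 2) ^ (2 * m - 1) * v * (n : ℝ) ^ (2 * m) :=
    calc (48 * m ^ 2) ^ m * (n * v) = (48 * m ^ 2) ^ m * n * v := by ring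
      _ ≤ (96 * m / n) ^ (2 * m - 1) * (n : ℝ) ^ (2 * m) * v :=
          mul_le_mul_of_nonneg_right (mul_sq_rpow_mul_le hm hn_pos) hv
      _ ≤ (θ ^ 2) ^ (2 * m - 1) * (n : ℝ) ^ (2 * m) * v := by
          have : 0 ≤ 2 * m - 1 := by linarith
          gcongr
      _ = _ := by ring
  simp_rw [abs_div, Nat.abs_cast, Real.div_rpow (abs_nonneg _) hn_pos.le]
  rw [← Finset.sum_div, div_le_iff₀ (by positivity), mul_assoc, add_mul]
  refine (sum_abs_sum_rpow_le hm hv hy_sum hy_abs hy_sq).trans ?_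
  gcongr

end Moments

section CrootSisask

open MeasureTheory

lemma card_le_two_mul_card_filter_le {ι : Type*} (s : Finset ι) (E : ι → ENNReal) {M : ENNReal}
    (h : ∑ a ∈ s, E a ≤ s.card * M) :
    s.card ≤ 2 * (s.filter fun a => E a ≤ 2 * M).card := by
  rcases eq_or_ne M 0 with rfl | hM₀
  · rw [mul_zero, nonpos_iff_eq_zero, Finset.sum_eq_zero_iff] at h
    rw [Finset.filter_true_of_mem fun a ha => (h a ha).trans_le zero_le]
    omega
  rcases eq_or_ne M ⊤ with rfl | hM_top
  · rw [Finset.filter_true_of_mem fun a _ => le_top.trans_eq (ENNReal.mul_top two_ne_zero).symm]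
    omega
  set bad := s.filter fun a => ¬ E a ≤ 2 * M
  have hbad : ((bad.card * 2 : ℕ) : ENNReal) * M ≤ s.card * M :=
    calc ((bad.card * 2 : ℕ) : ENNReal) * M = bad.card • (2 * M) := by
          rw [nsmul_eq_mul]
          push_cast
          ring
      _ ≤ ∑ a ∈ bad, E a :=
          Finset.card_nsmul_le_sum _ _ _ fun a ha => (not_le.1 (Finset.mem_filter.1 ha).2).le
      _ ≤ ∑ a ∈ s, E a := Finset.sum_le_sum_of_subset (Finset.filter_subset _ _)
      _ ≤ s.card * M := h
  have hbad_card : bad.card * 2 ≤ s.card := by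
    exact_mod_cast (ENNReal.mul_le_mul_iff_left hM₀ hM_top).1 hbad
  have hpartition : (s.filter fun a => E a ≤ 2 * M).card + bad.card = s.card :=
    Finset.card_filter_add_card_filter_not _
  omega

lemma eLpNorm_ofReal_eq {α : Type*} [MeasurableSpace α] {p : ℝ} (hp : 0 < p) (u : α → ℝ)
    (μ : Measure α) :
    eLpNorm u (ENNReal.ofReal p) μ = (∫⁻ x, ENNReal.ofReal (|u x| ^ p) ∂μ) ^ (1 / p) := by
  rw [eLpNorm_eq_lintegral_rpow_enorm_toReal (ENNReal.ofReal_pos.2 hp).ne' ENNReal.ofReal_ne_top,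
    ENNReal.toReal_ofReal hp.le]
  simp_rw [Real.enorm_eq_ofReal_abs, ENNReal.ofReal_rpow_of_nonneg (abs_nonneg _) hp.le]

lemma lintegral_rpow_add_mul_eq {α : Type*} [MeasurableSpace α] {m a b : ℝ} (hm : 0 < m)
    (ha : 0 ≤ a) (hb : 0 ≤ b) {f : α → ℝ} (hf : ∀ x, 0 ≤ f x) (hf_meas : Measurable f)
    (μ : Measure α) :
    ∫⁻ x, ENNReal.ofReal (a * f x ^ m + b * f x) ∂μ
      = ENNReal.ofReal a * eLpNorm f (ENNReal.ofReal m) μ ^ m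
        + ENNReal.ofReal b * eLpNorm f 1 μ := by
  have hLm : eLpNorm f (ENNReal.ofReal m) μ ^ m = ∫⁻ x, ENNReal.ofReal (f x ^ m) ∂μ := by
    rw [eLpNorm_ofReal_eq hm, ← ENNReal.rpow_mul, one_div_mul_cancel hm.ne', ENNReal.rpow_one]
    simp_rw [abs_of_nonneg (hf _)]
  have hL1 : eLpNorm f 1 μ = ∫⁻ x, ENNReal.ofReal (f x) ∂μ := by
    rw [eLpNorm_one_eq_lintegral_enorm]
    simp_rw [Real.enorm_eq_ofReal (hf _)]
  rw [hLm, hL1, ← lintegral_const_mul _ (by fun_prop), ← lintegral_const_mul _ (by fun_prop),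
    ← lintegral_add_left (by fun_prop)]
  refine lintegral_congr fun x => ?_
  have := hf x
  rw [← ENNReal.ofReal_mul ha, ← ENNReal.ofReal_mul hb,
    ENNReal.ofReal_add (by positivity) (by positivity)]

lemma two_mul_lintegral_rpow_le {α : Type*} [MeasurableSpace α] {m θ : ℝ} (hm : 1 ≤ m) (hθ : 0 < θ)
    {f : α → ℝ} (hf : ∀ x, 0 ≤ f x) (hf_meas : Measurable f) (μ : Measure α) :
    (2 * ∫⁻ x, ENNReal.ofReal ((θ ^ 2) ^ m * f x ^ m + (θ ^ 2) ^ (2 * m - 1) * f x) ∂μ)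
        ^ (1 / (2 * m))
      ≤ 2 * (ENNReal.ofReal θ * eLpNorm f (ENNReal.ofReal m) μ ^ (1 / 2 : ℝ)
          + ENNReal.ofReal (θ ^ (2 - 1 / m)) * eLpNorm f 1 μ ^ (1 / (2 * m))) := by
  have hm_pos : 0 < m := by linarith
  have hp₀ : 0 ≤ 1 / (2 * m) := by positivity
  have hp₁ : 1 / (2 * m) ≤ 1 := (div_le_one (by positivity)).2 (by linarith)
  have hθ_rpow (e : ℝ) : ((θ ^ 2) ^ e) ^ (1 / (2 * m)) = θ ^ (e / m) := by
    rw [← Real.rpow_two, ← Real.rpow_mul hθ.le, ← Real.rpow_mul hθ.le]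
    congr 1
    field_simp
  have htwo : (2 : ENNReal) ^ (1 / (2 * m)) ≤ 2 := by
    simpa only [ENNReal.rpow_one] using
      ENNReal.rpow_le_rpow_of_exponent_le (one_le_two (α := ENNReal)) hp₁
  rw [lintegral_rpow_add_mul_eq hm_pos (by positivity) (by positivity) hf hf_meas,
    ENNReal.mul_rpow_of_nonneg _ _ hp₀]
  refine mul_le_mul' htwo ((ENNReal.rpow_add_le_add_rpow _ _ hp₀ hp₁).trans_eq ?_)
  rw [ENNReal.mul_rpow_of_nonneg _ _ hp₀, ENNReal.mul_rpow_of_nonneg _ _ hp₀,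
    ENNReal.ofReal_rpow_of_nonneg (by positivity) hp₀,
    ENNReal.ofReal_rpow_of_nonneg (by positivity) hp₀, ← ENNReal.rpow_mul, hθ_rpow, hθ_rpow,
    div_self hm_pos.ne', Real.rpow_one, sub_div, mul_div_cancel_right₀ _ hm_pos.ne']
  congr 3
  field_simp

variable {G : Type*} [AddCommGroup G] [DecidableEq G]

lemma exists_subset_sub_mem_of_card [Finite G] {A S : Finset G} {n : ℕ} {J : Finset (Fin n → G)}
    (hJ : J ⊆ Fintype.piFinset fun _ => A) :
    ∃ z : Fin n → G, ∃ T ⊆ S, (∀ t ∈ T, (fun i => z i - t) ∈ J) ∧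
      J.card * S.card ≤ T.card * (A + S).card ^ n := by
  set T : (Fin n → G) → Finset G := fun z => S.filter fun t => (fun i => z i - t) ∈ J
  obtain ⟨z, hz⟩ := Finite.exists_max fun z => (T z).card
  refine ⟨z, T z, Finset.filter_subset _ _, fun t ht => (Finset.mem_filter.1 ht).2, ?_⟩
  have hmaps : ∀ q ∈ J ×ˢ S, (fun i => q.1 i + q.2) ∈ Fintype.piFinset fun _ : Fin n => A + S :=
    fun q hq => Fintype.mem_piFinset.2 fun i => Finset.add_mem_add
      (Fintype.mem_piFinset.1 (hJ (Finset.mem_product.1 hq).1) i) (Finset.mem_product.1 hq).2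
  have hfiber (w : Fin n → G) :
      ((J ×ˢ S).filter fun q => (fun i => q.1 i + q.2) = w).card ≤ (T z).card := by
    refine (Finset.card_le_card_of_injOn Prod.snd (fun q hq => ?_) fun q hq q' hq' h => ?_).trans
      (hz w)
    · obtain ⟨hqJS, rfl⟩ := Finset.mem_filter.1 hq
      refine Finset.mem_filter.2 ⟨(Finset.mem_product.1 hqJS).2, ?_⟩
      simpa only [add_sub_cancel_right] using (Finset.mem_product.1 hqJS).1
    · refine Prod.ext (funext fun i => ?_) h
      have hi := (congrFun (Finset.mem_filter.1 hq).2 i).trans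
        (congrFun (Finset.mem_filter.1 hq').2 i).symm
      exact add_right_cancel (hi.trans (by rw [h]))
  simpa only [Finset.card_product, Fintype.card_piFinset_const] using
    Finset.card_le_mul_card_image_of_maps_to hmaps (T z).card fun w _ => hfiber w

/-- The average of the translates of `1_L` by the entries of `a`: an empirical approximation of
`conv (unif A) (ind L)` when the entries of `a` are sampled from `A`. -/
noncomputable def translateAvg {n : ℕ} (L : Finset G) (a : Fin n → G) (x : G) : ℝ :=
  (∑ i, ind L (x - a i)) / n

lemma translateAvg_add {n : ℕ} (L : Finset G) (a : Fin n → G) (x t : G) :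
    translateAvg L a (x + t) = translateAvg L (fun i => a i - t) x := by
  simp only [translateAvg, sub_sub_eq_add_sub]

variable [Fintype G]

lemma card_mul_conv_unif {A : Finset G} (hA : A.Nonempty) (u : G → ℝ) (x : G) :
    A.card * conv (unif A) u x = ∑ a ∈ A, u (x - a) := by
  rw [conv_unif_apply, mul_div_cancel₀ _ (Nat.cast_ne_zero.2 hA.card_ne_zero)]

lemma conv_unif_ind_nonneg (A L : Finset G) (x : G) : 0 ≤ conv (unif A) (ind L) x :=
  conv_unif_nonneg A (ind_nonneg L) x

lemma conv_unif_ind_le_one (A L : Finset G) (x : G) : conv (unif A) (ind L) x ≤ 1 := by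
  rw [conv_unif_apply]
  refine div_le_one_of_le₀ ?_ (Nat.cast_nonneg _)
  simpa using Finset.sum_le_card_nsmul A _ 1 fun a _ => ind_le_one L (x - a)

lemma sum_ind_sub_conv_sq {A : Finset G} (hA : A.Nonempty) (L : Finset G) (x : G) :
    ∑ a ∈ A, (ind L (x - a) - conv (unif A) (ind L) x) ^ 2
      = A.card * (conv (unif A) (ind L) x * (1 - conv (unif A) (ind L) x)) := by
  set c := conv (unif A) (ind L) x
  have hsq (a : G) : (ind L (x - a) - c) ^ 2 = (1 - 2 * c) * ind L (x - a) + c ^ 2 := by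
    unfold ind
    split_ifs <;> ring
  simp_rw [hsq]
  rw [Finset.sum_add_distrib, ← Finset.mul_sum, ← card_mul_conv_unif hA, Finset.sum_const,
    nsmul_eq_mul]
  ring

lemma sum_abs_translateAvg_sub_rpow_le {A : Finset G} (hA : A.Nonempty) (L : Finset G) {m θ : ℝ}
    {n : ℕ} (hm : 1 ≤ m) (hn : 96 * m ≤ n * θ ^ 2) (x : G) {f : ℝ}
    (hf : f = conv (unif A) (ind L) x * (1 - conv (unif A) (ind L) x)) :
    ∑ a ∈ Fintype.piFinset fun _ : Fin n => A,
        |translateAvg L a x - conv (unif A) (ind L) x| ^ (2 * m)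
      ≤ A.card ^ n * ((θ ^ 2) ^ m * f ^ m + (θ ^ 2) ^ (2 * m - 1) * f) := by
  have hn₀ : (n : ℝ) ≠ 0 := fun h => by
    rw [h] at hn
    linarith
  have hc₀ := conv_unif_ind_nonneg A L x
  have hc₁ := conv_unif_ind_le_one A L x
  set c := conv (unif A) (ind L) x with hc
  have havg (a : Fin n → G) : translateAvg L a x - c = (∑ i, (ind L (x - a i) - c)) / n := by
    rw [translateAvg, Finset.sum_sub_distrib, sub_div, Finset.sum_const, Finset.card_univ,
      Fintype.card_fin, nsmul_eq_mul, mul_div_cancel_left₀ _ hn₀]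
  simp_rw [havg]
  refine sum_abs_avg_rpow_le (y := fun b => ind L (x - b) - c) hm hn ?_ ?_ (fun b _ => ?_) ?_
  · rw [hf]
    exact mul_nonneg hc₀ (by linarith)
  · rw [Finset.sum_sub_distrib, ← card_mul_conv_unif hA, Finset.sum_const, nsmul_eq_mul, sub_self]
  · exact abs_le.2 ⟨by linarith [ind_nonneg L (x - b)], by linarith [ind_le_one L (x - b)]⟩
  · rw [hf, hc]
    exact (sum_ind_sub_conv_sq hA L x).le

variable [MeasurableSpace G] [DiscreteMeasurableSpace G]

lemma exists_half_translateAvg_eLpNorm_le {A : Finset G} (hA : A.Nonempty) (L : Finset G) {m θ : ℝ}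
    {n : ℕ} (hm : 1 ≤ m) (hθ : 0 < θ) (hn : 96 * m ≤ n * θ ^ 2) (μ : Measure G) {g f : G → ℝ}
    (hg : g = conv (unif A) (ind L)) (hf : f = fun x => g x * (1 - g x)) :
    ∃ J ⊆ Fintype.piFinset fun _ : Fin n => A, A.card ^ n ≤ 2 * J.card ∧ ∀ a ∈ J,
      eLpNorm (fun x => translateAvg L a x - g x) (ENNReal.ofReal (2 * m)) μ ≤
        2 * (ENNReal.ofReal θ * eLpNorm f (ENNReal.ofReal m) μ ^ (1 / 2 : ℝ)
          + ENNReal.ofReal (θ ^ (2 - 1 / m)) * eLpNorm f 1 μ ^ (1 / (2 * m))) := by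
  classical
  subst hg hf
  set g := conv (unif A) (ind L)
  set f : G → ℝ := fun x => g x * (1 - g x)
  have hf (x : G) : 0 ≤ f x :=
    mul_nonneg (conv_unif_ind_nonneg A L x) (by linarith [conv_unif_ind_le_one A L x])
  set I := Fintype.piFinset fun _ : Fin n => A
  have hI : I.card = A.card ^ n := Fintype.card_piFinset_const A n
  set E : (Fin n → G) → ENNReal := fun a =>
    ∫⁻ x, ENNReal.ofReal (|translateAvg L a x - g x| ^ (2 * m)) ∂μ
  set M := ∫⁻ x, ENNReal.ofReal ((θ ^ 2) ^ m * f x ^ m + (θ ^ 2) ^ (2 * m - 1) * f x) ∂μ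
  have hE : ∑ a ∈ I, E a ≤ I.card * M := by
    rw [← lintegral_finsetSum _ fun _ _ => Measurable.of_discrete,
      ← lintegral_const_mul _ Measurable.of_discrete]
    refine lintegral_mono fun x => ?_
    rw [← ENNReal.ofReal_sum_of_nonneg fun _ _ => by positivity, ← ENNReal.ofReal_natCast,
      ← ENNReal.ofReal_mul (by positivity), hI, Nat.cast_pow]
    exact ENNReal.ofReal_le_ofReal (sum_abs_translateAvg_sub_rpow_le hA L hm hn x rfl)
  refine ⟨I.filter fun a => E a ≤ 2 * M, Finset.filter_subset _ _,
    hI.symm.trans_le (card_le_two_mul_card_filter_le I E hE), fun a ha => ?_⟩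
  rw [eLpNorm_ofReal_eq (by positivity)]
  exact (ENNReal.rpow_le_rpow (Finset.mem_filter.1 ha).2 (by positivity)).trans
    (two_mul_lintegral_rpow_le hm hθ hf Measurable.of_discrete μ)

theorem croot_sisask {A S : Finset G} (hA : A.Nonempty) (hS : S.Nonempty) (L : Finset G)
    {m θ K : ℝ} {n : ℕ} (hm : 1 ≤ m) (hθ : 0 < θ) (hn : 96 * m ≤ n * θ ^ 2)
    (hAS : ((A + S).card : ℝ) ≤ K * A.card) (μ : Measure G) {g f : G → ℝ}
    (hg : g = conv (unif A) (ind L)) (hf : f = fun x => g x * (1 - g x)) :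
    ∃ T ⊆ S, T.Nonempty ∧ (S.card : ℝ) ≤ 2 * K ^ n * T.card ∧ ∃ h : G → ℝ, ∀ t ∈ T,
      eLpNorm (fun x => h (x + t) - g x) (ENNReal.ofReal (2 * m)) μ ≤
        2 * (ENNReal.ofReal θ * eLpNorm f (ENNReal.ofReal m) μ ^ (1 / 2 : ℝ)
          + ENNReal.ofReal (θ ^ (2 - 1 / m)) * eLpNorm f 1 μ ^ (1 / (2 * m))) := by
  obtain ⟨J, hJ, hJ_card, hJ_norm⟩ := exists_half_translateAvg_eLpNorm_le hA L hm hθ hn μ hg hf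
  obtain ⟨z, T, hTS, hT_mem, hT_card⟩ := exists_subset_sub_mem_of_card (S := S) hJ
  have hA_card : (0 : ℝ) < A.card := by exact_mod_cast hA.card_pos
  have hS_card : (0 : ℝ) < S.card := by exact_mod_cast hS.card_pos
  have hcard : (S.card : ℝ) ≤ 2 * K ^ n * T.card := by
    refine le_of_mul_le_mul_left ?_ (pow_pos hA_card n)
    calc (A.card : ℝ) ^ n * S.card ≤ 2 * J.card * S.card := by
          gcongr
          exact_mod_cast hJ_card
      _ = 2 * (J.card * S.card) := by ring
      _ ≤ 2 * (T.card * (A + S).card ^ n) :=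
          mul_le_mul_of_nonneg_left (by exact_mod_cast hT_card) zero_le_two
      _ ≤ 2 * (T.card * (K * A.card) ^ n) := by gcongr
      _ = A.card ^ n * (2 * K ^ n * T.card) := by ring
  refine ⟨T, hTS, ?_, hcard, translateAvg L z, fun t ht => ?_⟩
  · by_contra hT
    rw [Finset.not_nonempty_iff_eq_empty.1 hT, Finset.card_empty, Nat.cast_zero, mul_zero] at hcard
    exact hcard.not_gt hS_card
  · simp_rw [translateAvg_add]
    exact hJ_norm _ (hT_mem t ht)

end CrootSisask

section IteratedSumset

variable {G : Type*} [AddCommGroup G] {X : Set G}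

lemma zero_mem_iteratedSumset_zero (X : Set G) : (0 : G) ∈ iteratedSumset 0 X :=
  ⟨0, fun i => i.elim0, by simp⟩

lemma add_mem_iteratedSumset {r : ℕ} {x y : G} (hx : x ∈ iteratedSumset r X) (hy : y ∈ X) :
    x + y ∈ iteratedSumset (r + 1) X := by
  obtain ⟨s, hs, rfl⟩ := hx
  refine ⟨Fin.snoc s y, fun i => ?_, ?_⟩
  · cases i using Fin.lastCases with
    | last => simpa only [Fin.snoc_last] using hy
    | cast j => simpa only [Fin.snoc_castSucc] using hs j
  · simp only [Fin.sum_univ_castSucc, Fin.snoc_castSucc, Fin.snoc_last]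

lemma iteratedSumset_mono (hX₀ : (0 : G) ∈ X) {r r' : ℕ} (h : r ≤ r') :
    iteratedSumset r X ⊆ iteratedSumset r' X := by
  induction h with
  | refl => exact subset_rfl
  | step _ ih => exact fun x hx => by simpa only [add_zero] using add_mem_iteratedSumset (ih hx) hX₀

lemma neg_mem_iteratedSumset (hXneg : ∀ x ∈ X, -x ∈ X) {r : ℕ} {x : G}
    (hx : x ∈ iteratedSumset r X) : -x ∈ iteratedSumset r X := by
  obtain ⟨s, hs, rfl⟩ := hx
  exact ⟨fun i => -s i, fun i => hXneg _ (hs i), Finset.sum_neg_distrib _ |>.symm⟩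

lemma add_sub_mem_iteratedSumset (hXneg : ∀ x ∈ X, -x ∈ X) {r : ℕ} {s x y : G}
    (hs : s ∈ iteratedSumset r X) (hx : x ∈ X) (hy : y ∈ X) :
    s + x - y ∈ iteratedSumset (r + 2) X := by
  rw [sub_eq_add_neg]
  exact add_mem_iteratedSumset (add_mem_iteratedSumset hs hx) (hXneg y hy)

end IteratedSumset

section AlmostPeriodicity

open MeasureTheory

lemma eLpNorm_average_le {ι α : Type*} [MeasurableSpace α] {T : Finset ι} (hT : T.Nonempty)
    {V : ι → α → ℝ} {p c : ENNReal} (hp : 1 ≤ p) {ν : Measure α}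
    (hV : ∀ t ∈ T, AEStronglyMeasurable (V t) ν) (h : ∀ t ∈ T, eLpNorm (V t) p ν ≤ c) :
    eLpNorm (fun x => (∑ t ∈ T, V t x) / T.card) p ν ≤ c := by
  have havg : (fun x => (∑ t ∈ T, V t x) / T.card) = (T.card : ℝ)⁻¹ • ∑ t ∈ T, V t := by
    funext x
    rw [Pi.smul_apply, Finset.sum_apply, smul_eq_mul, div_eq_inv_mul]
  have hinv : ‖(T.card : ℝ)⁻¹‖ₑ = (T.card : ENNReal)⁻¹ := by
    rw [enorm_inv (Nat.cast_ne_zero.2 hT.card_ne_zero), Real.enorm_natCast]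
  rw [havg, eLpNorm_const_smul, hinv]
  calc (T.card : ENNReal)⁻¹ * eLpNorm (∑ t ∈ T, V t) p ν
      ≤ (T.card : ENNReal)⁻¹ * ∑ t ∈ T, eLpNorm (V t) p ν := by
        gcongr
        exact eLpNorm_sum_le hV hp
    _ ≤ (T.card : ENNReal)⁻¹ * (T.card * c) := by
        gcongr
        simpa only [nsmul_eq_mul] using Finset.sum_le_card_nsmul T _ c h
    _ = c := ENNReal.inv_mul_cancel_left (by simpa using hT.ne_empty) (ENNReal.natCast_ne_top _)

lemma eLpNorm_shift_sub_le_of_abs_le {G : Type*} [Add G] [MeasurableSpace G] {u : G → ℝ} {t : G}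
    {δ q : ℝ} (hq : 0 < q) (h : ∀ x, |u (x + t) - u x| ≤ δ) (ν : Measure G) :
    eLpNorm (fun x => u (x + t) - u x) (ENNReal.ofReal q) ν
      ≤ ENNReal.ofReal δ * ν Set.univ ^ (1 / q) := by
  have hbound := eLpNorm_le_of_ae_bound (p := ENNReal.ofReal q) (μ := ν)
    (f := fun x => u (x + t) - u x) (C := δ) (Filter.Eventually.of_forall h)
  rwa [ENNReal.toReal_ofReal hq.le, ← one_div, mul_comm] at hbound

section Invariance

variable {G : Type*} [AddCommGroup G] [Countable G] [MeasurableSpace G] [DiscreteMeasurableSpace G]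
  {ν μ : Measure G} {p b : ENNReal}

lemma eLpNorm_shift_le {R : Set G} (hinv : IsInvariantPair R ν μ) {s : G} (hs : -s ∈ R)
    (u : G → ℝ) (p : ENNReal) : eLpNorm (fun x => u (x + s)) p ν ≤ eLpNorm u p μ := by
  have hmap : ν.map (· + s) ≤ μ := Measure.le_iff.2 fun Y hY => by
    rw [Measure.map_apply Measurable.of_discrete hY]
    refine le_of_eq_of_le (congrArg ν ?_) (hinv _ hs Y hY)
    rw [Set.image_add_left, neg_neg]
    exact Set.ext fun x => by rw [Set.mem_preimage, Set.mem_preimage, add_comm]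
  calc eLpNorm (fun x => u (x + s)) p ν = eLpNorm u p (ν.map (· + s)) :=
        (eLpNorm_map_measure .of_discrete Measurable.of_discrete.aemeasurable).symm
    _ ≤ eLpNorm u p μ := eLpNorm_mono_measure u hmap

lemma eLpNorm_shift_sub_shift_le {X T : Set G} {r : ℕ} {g h : G → ℝ} (hX₀ : (0 : G) ∈ X)
    (hXneg : ∀ x ∈ X, -x ∈ X) (hinv : IsInvariantPair (iteratedSumset r X) ν μ) (hp : 1 ≤ p)
    (hTX : T ⊆ X) (hb : ∀ t ∈ T, eLpNorm (fun x => h (x + t) - g x) p μ ≤ b) {t t₀ s : G}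
    (ht : t ∈ T) (ht₀ : t₀ ∈ T) {j : ℕ} (hj : j + 2 ≤ r) (hs : s ∈ iteratedSumset j X) :
    eLpNorm (fun x => g (x + (s + t₀ - t)) - g (x + s)) p ν ≤ 2 * b := by
  have htriangle : (fun x => g (x + (s + t₀ - t)) - g (x + s))
      = (fun x => h (x + s + t₀) - g (x + s))
        - (fun x => h (x + (s + t₀ - t) + t) - g (x + (s + t₀ - t))) := by
    funext x
    simp only [Pi.sub_apply, add_assoc, sub_add_cancel, sub_sub_sub_cancel_left]
  rw [htriangle, two_mul]
  refine (eLpNorm_sub_le .of_discrete .of_discrete hp).trans (add_le_add ?_ ?_)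
  · have hs_neg : -s ∈ iteratedSumset r X :=
      iteratedSumset_mono hX₀ (by omega) (neg_mem_iteratedSumset hXneg hs)
    exact (eLpNorm_shift_le hinv hs_neg (fun x => h (x + t₀) - g x) p).trans (hb t₀ ht₀)
  · have hst_neg := iteratedSumset_mono hX₀ hj
      (neg_mem_iteratedSumset hXneg (add_sub_mem_iteratedSumset hXneg hs (hTX ht₀) (hTX ht)))
    exact (eLpNorm_shift_le hinv hst_neg (fun x => h (x + t) - g x) p).trans (hb t ht)

end Invariance

variable {G : Type*} [AddCommGroup G] [Fintype G] [DecidableEq G]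

/-- The average of the translates of `u` by `t₀ - t`, `t ∈ T`. For `t₀ ∈ T` only translations in
`T - T` occur; this is what makes the invariance of a pair of measures applicable. -/
noncomputable def smooth (T : Finset G) (t₀ : G) (u : G → ℝ) (x : G) : ℝ :=
  conv (unif T) u (x + t₀)

lemma smooth_sub {T : Finset G} (hT : T.Nonempty) (t₀ : G) (u : G → ℝ) (x : G) (c : ℝ) :
    smooth T t₀ u x - c = (∑ t ∈ T, (u (x + t₀ - t) - c)) / T.card := by
  rw [smooth, conv_unif_apply, Finset.sum_sub_distrib, Finset.sum_const, nsmul_eq_mul, sub_div,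
    mul_div_cancel_left₀ _ (Nat.cast_ne_zero.2 hT.card_ne_zero)]

lemma norm_ft_iterate_smooth (T : Finset G) (t₀ : G) (u : G → ℝ) (k : ℕ) (γ : AddChar G ℂ) :
    ‖ft ((smooth T t₀)^[k] u) γ‖ = ‖ft (unif T) γ‖ ^ k * ‖ft u γ‖ := by
  induction k with
  | zero => simp
  | succ k ih =>
    have hstep : ft (smooth T t₀ ((smooth T t₀)^[k] u)) γ
        = γ (-t₀) * (ft (unif T) γ * ft ((smooth T t₀)^[k] u) γ) := by
      rw [← ft_conv]
      exact ft_shift _ _ _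
    rw [Function.iterate_succ_apply', hstep, norm_mul, AddChar.norm_apply, one_mul, norm_mul, ih,
      pow_succ', mul_assoc]

lemma norm_ft_unif_pow_mul_norm_char_sub_one_le (T : Finset G) {κ : ℝ} {k : ℕ}
    (hk : (1 / 2 : ℝ) ^ k * 2 ≤ κ) {t : G} {γ : AddChar G ℂ}
    (ht : 1 / 2 ≤ ‖ft (unif T) γ‖ → ‖γ t - 1‖ ≤ κ) :
    ‖ft (unif T) γ‖ ^ k * ‖γ t - 1‖ ≤ κ := by
  rcases le_or_gt (1 / 2) ‖ft (unif T) γ‖ with hlarge | hsmall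
  · exact (mul_le_of_le_one_left (norm_nonneg _)
      (pow_le_one₀ (norm_nonneg _) (norm_ft_unif_le_one T γ))).trans (ht hlarge)
  · have htwo : ‖γ t - 1‖ ≤ 2 := by
      refine (norm_sub_le _ _).trans_eq ?_
      rw [AddChar.norm_apply, norm_one, one_add_one_eq_two]
    calc ‖ft (unif T) γ‖ ^ k * ‖γ t - 1‖ ≤ (1 / 2) ^ k * 2 := by gcongr
      _ ≤ κ := hk

lemma abs_iterate_smooth_shift_sub_le (A L T : Finset G) {κ : ℝ} {k : ℕ}
    (hk : (1 / 2 : ℝ) ^ k * 2 ≤ κ) {t : G} (t₀ : G)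
    (ht : ∀ γ : AddChar G ℂ, 1 / 2 ≤ ‖ft (unif T) γ‖ → ‖γ t - 1‖ ≤ κ) (x : G) :
    |(smooth T t₀)^[k] (conv (unif A) (ind L)) (x + t)
      - (smooth T t₀)^[k] (conv (unif A) (ind L)) x| ≤ √(L.card / A.card) * κ := by
  set g := conv (unif A) (ind L)
  set F := (smooth T t₀)^[k] g
  have hκ : 0 ≤ κ := le_trans (by positivity) hk
  have hcard : (0 : ℝ) < Fintype.card G := Nat.cast_pos.2 (Fintype.card_pos_iff.2 ⟨x⟩)
  refine le_of_mul_le_mul_left ?_ hcard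
  calc Fintype.card G * |F (x + t) - F x|
      ≤ ∑ γ : AddChar G ℂ, ‖ft F γ‖ * ‖γ t - 1‖ := abs_shift_sub_le F x t
    _ ≤ ∑ γ : AddChar G ℂ, ‖ft g γ‖ * κ := by
        refine Finset.sum_le_sum fun γ _ => ?_
        rw [norm_ft_iterate_smooth, mul_right_comm, mul_comm]
        gcongr
        exact norm_ft_unif_pow_mul_norm_char_sub_one_le T hk (ht γ)
    _ ≤ Fintype.card G * √(L.card / A.card) * κ := by
        rw [← Finset.sum_mul]
        exact mul_le_mul_of_nonneg_right (sum_norm_ft_conv_unif_ind_le A L) hκ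
    _ = Fintype.card G * (√(L.card / A.card) * κ) := mul_assoc _ _ _

variable [MeasurableSpace G] [DiscreteMeasurableSpace G] {X : Set G} {T : Finset G} {r : ℕ}
  {ν μ : Measure G} {p b : ENNReal} {g h : G → ℝ}

lemma eLpNorm_iterate_smooth_sub_le (hX₀ : (0 : G) ∈ X) (hXneg : ∀ x ∈ X, -x ∈ X)
    (hinv : IsInvariantPair (iteratedSumset r X) ν μ) (hp : 1 ≤ p) (hTX : (T : Set G) ⊆ X)
    (hb : ∀ t ∈ T, eLpNorm (fun x => h (x + t) - g x) p μ ≤ b) {t₀ : G} (ht₀ : t₀ ∈ T)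
    (k : ℕ) {j : ℕ} (hj : j + 2 * k ≤ r) {s : G} (hs : s ∈ iteratedSumset j X) :
    eLpNorm (fun x => (smooth T t₀)^[k] g (x + s) - g (x + s)) p ν ≤ k * (2 * b) := by
  induction k generalizing j s with
  | zero => simp
  | succ k ih =>
    simp_rw [Function.iterate_succ_apply', smooth_sub ⟨t₀, ht₀⟩]
    refine eLpNorm_average_le ⟨t₀, ht₀⟩ hp (fun _ _ => .of_discrete) fun t ht => ?_
    set u := (smooth T t₀)^[k] g
    have htriangle : (fun x => u (x + s + t₀ - t) - g (x + s))
        = (fun x => u (x + (s + t₀ - t)) - g (x + (s + t₀ - t)))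
          + fun x => g (x + (s + t₀ - t)) - g (x + s) := by
      funext x
      simp only [Pi.add_apply, sub_add_sub_cancel, add_assoc, add_sub_assoc]
    have hsmooth : eLpNorm (fun x => u (x + (s + t₀ - t)) - g (x + (s + t₀ - t))) p ν
        ≤ k * (2 * b) :=
      ih (j := j + 2) (by omega) (add_sub_mem_iteratedSumset hXneg hs (hTX ht₀) (hTX ht))
    have hshift := eLpNorm_shift_sub_shift_le hX₀ hXneg hinv hp hTX hb ht ht₀ (by omega) hs
    calc eLpNorm (fun x => u (x + s + t₀ - t) - g (x + s)) p ν ≤ k * (2 * b) + 2 * b := by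
          rw [htriangle]
          exact (eLpNorm_add_le .of_discrete .of_discrete hp).trans (add_le_add hsmooth hshift)
      _ = (k + 1 : ℕ) * (2 * b) := by rw [Nat.cast_succ, add_one_mul]

lemma eLpNorm_shift_sub_le_of_smooth {k : ℕ} {c : ENNReal} (hX₀ : (0 : G) ∈ X)
    (hXneg : ∀ x ∈ X, -x ∈ X) (hinv : IsInvariantPair (iteratedSumset r X) ν μ) (hp : 1 ≤ p)
    (hTX : (T : Set G) ⊆ X) (hb : ∀ t ∈ T, eLpNorm (fun x => h (x + t) - g x) p μ ≤ b) {t₀ : G}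
    (ht₀ : t₀ ∈ T) (hk : 1 + 2 * k ≤ r) {t : G} (ht : t ∈ X)
    (hc : eLpNorm (fun x => (smooth T t₀)^[k] g (x + t) - (smooth T t₀)^[k] g x) p ν ≤ c) :
    eLpNorm (fun x => g (x + t) - g x) p ν ≤ 4 * k * b + c := by
  set F := (smooth T t₀)^[k] g
  have hshifted : eLpNorm (fun x => F (x + t) - g (x + t)) p ν ≤ k * (2 * b) :=
    eLpNorm_iterate_smooth_sub_le hX₀ hXneg hinv hp hTX hb ht₀ k hk
      (by simpa only [zero_add] using add_mem_iteratedSumset (zero_mem_iteratedSumset_zero X) ht)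
  have hunshifted : eLpNorm (fun x => F x - g x) p ν ≤ k * (2 * b) := by
    simpa only [add_zero] using eLpNorm_iterate_smooth_sub_le hX₀ hXneg hinv hp hTX hb ht₀ k
      (j := 0) (by omega) (zero_mem_iteratedSumset_zero X)
  have htriangle : (fun x => g (x + t) - g x)
      = ((fun x => F (x + t) - F x) + fun x => F x - g x) - fun x => F (x + t) - g (x + t) := by
    funext x
    simp only [Pi.add_apply, Pi.sub_apply]
    ring
  calc eLpNorm (fun x => g (x + t) - g x) p ν ≤ c + k * (2 * b) + k * (2 * b) := by
        rw [htriangle]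
        exact (eLpNorm_sub_le .of_discrete .of_discrete hp).trans (add_le_add
          ((eLpNorm_add_le .of_discrete .of_discrete hp).trans (add_le_add hc hunshifted)) hshifted)
    _ = 4 * k * b + c := by ring

end AlmostPeriodicity

section BohrSubset

variable {G : Type*} [AddCommGroup G]

lemma BohrSet.IsSub.carrier_subset {B' B : BohrSet G} (h : B'.IsSub B) :
    B'.carrier ⊆ B.carrier :=
  fun _ hx γ hγ => (hx γ (h.1 hγ)).trans h.2

lemma one_le_ncard_div_card {α : Type*} [Finite α] {S : Finset α} (hS : S.Nonempty) {X : Set α}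
    (hSX : (S : Set α) ⊆ X) : (1 : ℝ) ≤ X.ncard / S.card :=
  (one_le_div (Nat.cast_pos.2 hS.card_pos)).2
    (Nat.cast_le.2 (Set.ncard_coe_finset S ▸ Set.ncard_le_ncard hSX))

lemma exists_regular_isSub [Finite G] {B : BohrSet G} (hrank : 1 ≤ B.rank)
    (Λ : Finset (AddChar G ℂ)) {σ : ℝ} (hσ₀ : 0 ≤ σ) (hσ : σ ≤ B.radius) :
    ∃ B' : BohrSet G, B'.IsRegular ∧ B'.IsSub B ∧ B'.rank ≤ B.rank + Λ.card ∧
      σ / 4096 ≤ B'.radius ∧ B'.carrier ⊆ bohr B.freqs σ ∧ B'.carrier ⊆ bohr Λ σ := by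
  classical
  obtain ⟨B', hfreqs, hradius_ge, hradius_le, hreg⟩ := exists_regular_dilate (Γ := B.freqs ∪ Λ)
    ((Finset.card_pos.1 hrank).mono Finset.subset_union_left) hσ₀
  refine ⟨B', hreg, ⟨hfreqs ▸ Finset.subset_union_left, hradius_le.trans hσ⟩, ?_, hradius_ge,
    fun x hx γ hγ => ?_, fun x hx γ hγ => ?_⟩
  · rw [BohrSet.rank, hfreqs]
    exact Finset.card_union_le _ _
  · exact (hx γ (hfreqs ▸ Finset.mem_union_left Λ hγ)).trans hradius_le
  · exact (hx γ (hfreqs ▸ Finset.mem_union_right B.freqs hγ)).trans hradius_le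

lemma exists_regular_isSub_norm_char_sub_one_le [Fintype G] [DecidableEq G] {B : BohrSet G}
    (hB : B.IsRegular) (hrank : 1 ≤ B.rank) (hrad : B.radius ≤ 2) {T : Finset G} (hT : T.Nonempty)
    (hTB : (T : Set G) ⊆ B.carrier) {κ : ℝ} (hκ₀ : 0 ≤ κ) (hκ₁ : κ ≤ 1) {n : ℕ}
    (hn : 8 * Real.log (4 * (B.carrier.ncard / T.card)) < n) :
    ∃ B' : BohrSet G, B'.IsRegular ∧ B'.IsSub B ∧ B'.rank ≤ B.rank + n ∧
      B.radius * κ / (19327352832 * B.rank ^ 2 * n) ≤ B'.radius ∧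
      ∀ t ∈ B'.carrier, ∀ γ : AddChar G ℂ, 1 / 2 ≤ ‖ft (unif T) γ‖ → ‖γ t - 1‖ ≤ κ := by
  obtain ⟨Λ, hΛ, hspec⟩ := chang_bohr hB hrank hrad hT hTB hκ₀ hκ₁ hn
  set σ := B.radius * κ / (4718592 * B.rank ^ 2 * n) with hσ_def
  have hρ := B.radius_nonneg
  have hn_pos : 1 ≤ n := by
    have hlog : 0 ≤ Real.log (4 * (B.carrier.ncard / T.card)) :=
      Real.log_nonneg (by linarith [one_le_ncard_div_card hT hTB])
    exact_mod_cast (by linarith : (0 : ℝ) < n)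
  have hdenom : (1 : ℝ) ≤ 4718592 * B.rank ^ 2 * n := by
    exact_mod_cast Nat.mul_pos (Nat.mul_pos (by norm_num) (pow_pos hrank 2)) hn_pos
  have hσ : σ ≤ B.radius :=
    (div_le_self (by positivity) hdenom).trans (mul_le_of_le_one_right hρ hκ₁)
  obtain ⟨B', hreg, hsub, hrank', hrad', hfreqs, hΛ_sub⟩ :=
    exists_regular_isSub hrank Λ (by positivity) hσ
  refine ⟨B', hreg, hsub, hrank'.trans (by omega), le_of_eq_of_le ?_ hrad', fun t ht =>
    hspec t (hfreqs ht) (hΛ_sub ht)⟩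
  rw [hσ_def, div_div]
  ring

end BohrSubset

section Parameters

lemma eight_mul_div_rpow_le {ε m : ℝ} (hε : 0 < ε) (hm : 1 ≤ m) {k : ℕ} (hk : 1 ≤ k) :
    8 * k * (ε / (8 * k)) ^ (2 - 1 / m) ≤ ε ^ (2 - 1 / m) := by
  have hk_one : (1 : ℝ) ≤ 8 * k := by exact_mod_cast (by omega : 1 ≤ 8 * k)
  have hexponent : 1 ≤ 2 - 1 / m := by linarith [(div_le_one (by linarith)).2 hm]
  rw [Real.div_rpow hε.le (by positivity), mul_div_assoc', div_le_iff₀ (by positivity), mul_comm]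
  exact mul_le_mul_of_nonneg_left (Real.self_le_rpow_of_one_le hk_one hexponent) (by positivity)

lemma four_mul_two_mul_ofReal_le {ε m : ℝ} (hε : 0 < ε) (hm : 1 ≤ m) {k : ℕ} (hk : 1 ≤ k)
    (a b : ENNReal) :
    4 * k * (2 * (ENNReal.ofReal (ε / (8 * k)) * a
        + ENNReal.ofReal ((ε / (8 * k)) ^ (2 - 1 / m)) * b))
      ≤ ENNReal.ofReal ε * a + ENNReal.ofReal (ε ^ (2 - 1 / m)) * b := by
  have hmul (c : ℝ) : 8 * (k : ENNReal) * ENNReal.ofReal c = ENNReal.ofReal (8 * k * c) := by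
    rw [ENNReal.ofReal_mul (by positivity), ENNReal.ofReal_mul (by positivity),
      ENNReal.ofReal_natCast, ENNReal.ofReal_ofNat]
  have : (0 : ℝ) < k := Nat.cast_pos.2 hk
  calc 4 * k * (2 * (ENNReal.ofReal (ε / (8 * k)) * a
        + ENNReal.ofReal ((ε / (8 * k)) ^ (2 - 1 / m)) * b))
      = 8 * k * ENNReal.ofReal (ε / (8 * k)) * a
        + 8 * k * ENNReal.ofReal ((ε / (8 * k)) ^ (2 - 1 / m)) * b := by ring
    _ ≤ ENNReal.ofReal ε * a + ENNReal.ofReal (ε ^ (2 - 1 / m)) * b := by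
        rw [hmul, hmul, mul_div_cancel₀ ε (by positivity)]
        gcongr
        exact eight_mul_div_rpow_le hε hm hk

lemma half_le_log {x : ℝ} (hx : 2 ≤ x) : 1 / 2 ≤ Real.log x := by
  linarith [Real.log_two_gt_d9, Real.log_le_log two_pos hx]

lemma half_le_log_two_div {δ η : ℝ} (hδ₀ : 0 < δ) (hδ₁ : δ ≤ 1) (hη₀ : 0 < η) (hη₁ : η ≤ 1) :
    1 / 2 ≤ Real.log (2 / (δ * η)) :=
  half_le_log ((le_div_iff₀ (by positivity)).2 (by linarith [mul_le_one₀ hδ₁ hη₀.le hη₁]))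

lemma half_pow_mul_two_le {δ η : ℝ} (hδ : 0 < δ) (hη₀ : 0 < η) (hη₁ : η ≤ 1) {k : ℕ}
    (hk : 2 * Real.log (2 / (δ * η)) ≤ k) : (1 / 2 : ℝ) ^ k * 2 ≤ δ * √η := by
  have hpow : 2 / (δ * η) ≤ 2 ^ k := by
    rw [← Real.log_le_log_iff (by positivity) (by positivity), Real.log_pow]
    linarith [mul_le_mul_of_nonneg_left (half_le_log le_rfl) (Nat.cast_nonneg (α := ℝ) k)]
  have hsqrt : η ≤ √η := Real.le_sqrt_of_sq_le (pow_le_of_le_one hη₀.le hη₁ two_ne_zero)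
  rw [div_le_iff₀ (by positivity)] at hpow
  rw [one_div, inv_pow, inv_mul_le_iff₀ (by positivity)]
  exact hpow.trans (by gcongr)

lemma exists_sample_size {m ε : ℝ} (hm : 0 ≤ m) (hε : 0 < ε) {k : ℕ} (hk : 1 ≤ k) :
    ∃ n : ℕ, 96 * m ≤ n * (ε / (8 * k)) ^ 2 ∧ (n : ℝ) ≤ 6144 * (m * (ε ^ 2)⁻¹ * k ^ 2) + 1 := by
  have : (0 : ℝ) < k := Nat.cast_pos.2 hk
  set x := 6144 * (m * (ε ^ 2)⁻¹ * (k : ℝ) ^ 2) with hx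
  refine ⟨⌈x⌉₊, ?_, (Nat.ceil_lt_add_one (by positivity)).le⟩
  calc 96 * m = x * (ε / (8 * k)) ^ 2 := by
        rw [hx]
        field_simp
        ring
    _ ≤ ⌈x⌉₊ * (ε / (8 * k)) ^ 2 := by
        gcongr
        exact Nat.le_ceil x

lemma exists_rank_increment {K β : ℝ} (hK : 1 ≤ K) (hβ : 1 ≤ β) (n : ℕ) :
    ∃ d : ℕ, 0 < d ∧ 8 * Real.log (8 * K ^ n * β) < d ∧
      (d : ℝ) ≤ 8 * ((3 + n) * Real.log (2 * K) + Real.log β) + 1 := by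
  have hlog : Real.log (8 * K ^ n * β) ≤ (3 + n) * Real.log (2 * K) + Real.log β := by
    rw [Real.log_mul (by positivity) (by positivity)]
    gcongr
    calc Real.log (8 * K ^ n) ≤ Real.log ((2 * K) ^ (3 + n)) := by
          refine Real.log_le_log (by positivity) ?_
          rw [pow_add, mul_pow, mul_pow]
          have hK3 : (1 : ℝ) ≤ K ^ 3 := one_le_pow₀ hK
          have h2n : (1 : ℝ) ≤ 2 ^ n := one_le_pow₀ one_le_two
          gcongr
          · linarith
          · exact le_mul_of_one_le_left (by positivity) h2n
      _ = (3 + n) * Real.log (2 * K) := by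
          rw [Real.log_pow]
          push_cast
          rfl
  have hnonneg : 0 ≤ 8 * Real.log (8 * K ^ n * β) :=
    mul_nonneg (by norm_num) (Real.log_nonneg (one_le_mul_of_one_le_of_one_le
      (one_le_mul_of_one_le_of_one_le (by norm_num) (one_le_pow₀ hK)) hβ))
  refine ⟨⌊8 * Real.log (8 * K ^ n * β)⌋₊ + 1, Nat.succ_pos _, ?_, ?_⟩
  · exact_mod_cast Nat.lt_floor_add_one (8 * Real.log (8 * K ^ n * β))
  · push_cast
    linarith [Nat.floor_le hnonneg]

lemma rank_increment_le {M l lK lβ k n d : ℝ} (hM : 1 ≤ M) (hl : 1 / 2 ≤ l) (hlK : 1 / 2 ≤ lK)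
    (hlβ : 0 ≤ lβ) (hk₀ : 0 ≤ k) (hk : k ≤ 4 * l) (hn : n ≤ 6144 * (M * k ^ 2) + 1)
    (hd : d ≤ 8 * ((3 + n) * lK + lβ) + 1) : d ≤ 10 ^ 6 * (M * l ^ 2 * lK + lβ) := by
  set Q := M * l ^ 2 with hQ_def
  have hQ : 1 ≤ 4 * Q := by
    have hl_sq : (1 / 2) ^ 2 ≤ l ^ 2 := by gcongr
    linarith [le_mul_of_one_le_left (sq_nonneg l) hM]
  have hMk : M * k ^ 2 ≤ 16 * Q :=
    calc M * k ^ 2 ≤ M * (4 * l) ^ 2 := by gcongr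
      _ = 16 * Q := by
        rw [hQ_def]
        ring
  have hsample : (3 + n) * lK ≤ 98320 * (Q * lK) := by
    rw [← mul_assoc]
    gcongr
    linarith
  have hQlK : 1 ≤ 8 * (Q * lK) := by
    linarith [mul_le_mul hQ hlK (by norm_num) (by linarith)]
  linarith

lemma exists_parameters {m ε l K β : ℝ} (hm : 1 ≤ m) (hε₀ : 0 < ε) (hε₁ : ε < 1) (hl : 1 / 2 ≤ l)
    (hK : 1 ≤ K) (hβ : 1 ≤ β) :
    ∃ k n d : ℕ, 1 ≤ k ∧ 2 * l ≤ k ∧ (1 + 2 * k : ℝ) ≤ 10 * l ∧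
      96 * m ≤ n * (ε / (8 * k)) ^ 2 ∧ 0 < d ∧ 8 * Real.log (8 * K ^ n * β) < d ∧
      (d : ℝ) ≤ 10 ^ 6 * (m * (ε ^ 2)⁻¹ * l ^ 2 * Real.log (2 * K) + Real.log β) := by
  have hk : 1 ≤ ⌈2 * l⌉₊ := Nat.ceil_pos.2 (by linarith)
  have hk_le : (⌈2 * l⌉₊ : ℝ) ≤ 2 * l + 1 := (Nat.ceil_lt_add_one (by linarith)).le
  obtain ⟨n, hn, hn_le⟩ := exists_sample_size (m := m) (by linarith) hε₀ hk
  obtain ⟨d, hd_pos, hd, hd_le⟩ := exists_rank_increment hK hβ n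
  have hM : 1 ≤ m * (ε ^ 2)⁻¹ := one_le_mul_of_one_le_of_one_le hm
    ((one_le_inv₀ (by positivity)).2 (pow_le_one₀ hε₀.le hε₁.le))
  exact ⟨_, n, d, hk, Nat.le_ceil _, by linarith, hn, hd_pos, hd,
    rank_increment_le hM hl (half_le_log (by linarith)) (Real.log_nonneg hβ) (Nat.cast_nonneg _)
      (by linarith) hn_le hd_le⟩

end Parameters

section Main

open MeasureTheory

variable {G : Type*} [AddCommGroup G] [DecidableEq G]

lemma one_le_of_card_add_le {A S : Finset G} (hA : A.Nonempty) (hS : S.Nonempty) {K : ℝ}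
    (hAS : ((A + S).card : ℝ) ≤ K * A.card) : 1 ≤ K := by
  refine le_of_mul_le_mul_right ?_ (Nat.cast_pos.2 hA.card_pos)
  rw [one_mul]
  exact (Nat.cast_le.2 (Finset.card_le_card_add_right hS)).trans hAS

variable [Fintype G] [MeasurableSpace G] [DiscreteMeasurableSpace G]

/-- `n` is the number of samples in the Croot–Sisask lemma, `k` the number of smoothing steps, and
`d` bounds the number of new frequencies. -/
theorem exists_bohr_almost_periods {A S : Finset G} (hA : A.Nonempty) (hS : S.Nonempty)
    (L : Finset G) {B : BohrSet G} (hB : B.IsRegular) (hrank : 1 ≤ B.rank) (hrad : B.radius ≤ 2)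
    (hSB : (S : Set G) ⊆ B.carrier) {m ε κ K : ℝ} (hm : 1 ≤ m) (hε : 0 < ε) (hκ₁ : κ ≤ 1)
    (hAS : ((A + S).card : ℝ) ≤ K * A.card) {k n d r : ℕ} (hk : 1 ≤ k) (hkr : 1 + 2 * k ≤ r)
    (hkκ : (1 / 2 : ℝ) ^ k * 2 ≤ κ) (hn : 96 * m ≤ n * (ε / (8 * k)) ^ 2)
    (hd : 8 * Real.log (8 * K ^ n * (B.carrier.ncard / S.card)) < d) {ν μ : Measure G}
    (hinv : IsInvariantPair (iteratedSumset r B.carrier) ν μ) {g f : G → ℝ}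
    (hg : g = conv (unif A) (ind L)) (hf : f = fun x => g x * (1 - g x)) :
    ∃ B' : BohrSet G, B'.IsRegular ∧ B'.IsSub B ∧ B'.rank ≤ B.rank + d ∧
      B.radius * κ / (19327352832 * B.rank ^ 2 * d) ≤ B'.radius ∧ ∀ t ∈ B'.carrier,
        eLpNorm (fun x => g (x + t) - g x) (ENNReal.ofReal (2 * m)) ν
          ≤ ENNReal.ofReal ε * eLpNorm f (ENNReal.ofReal m) μ ^ (1 / 2 : ℝ)
            + ENNReal.ofReal (ε ^ (2 - 1 / m)) * eLpNorm f 1 μ ^ (1 / (2 * m))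
            + ENNReal.ofReal (√(L.card / A.card) * κ) * ν Set.univ ^ (1 / (2 * m)) := by
  have hθ : 0 < ε / (8 * k) := by
    have : (0 : ℝ) < k := Nat.cast_pos.2 hk
    positivity
  obtain ⟨T, hTS, hT, hT_card, h, hh⟩ := croot_sisask hA hS L hm hθ hn hAS μ hg hf
  have hTB : (T : Set G) ⊆ B.carrier := (Finset.coe_subset.2 hTS).trans hSB
  have hS_pos : (0 : ℝ) < S.card := Nat.cast_pos.2 hS.card_pos
  have hT_pos : (0 : ℝ) < T.card := Nat.cast_pos.2 hT.card_pos
  have hB_pos : (0 : ℝ) < B.carrier.ncard := Nat.cast_pos.2 (ncard_bohr_pos _ B.radius_nonneg)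
  have hdensity : 4 * ((B.carrier.ncard : ℝ) / T.card)
      ≤ 8 * K ^ n * (B.carrier.ncard / S.card) := by
    rw [mul_div_assoc', mul_div_assoc', div_le_div_iff₀ hT_pos hS_pos]
    linarith [mul_le_mul_of_nonneg_left hT_card hB_pos.le]
  have hκ₀ : 0 ≤ κ := le_trans (by positivity) hkκ
  obtain ⟨B', hreg, hsub, hrank', hrad', hspec⟩ := exists_regular_isSub_norm_char_sub_one_le hB
    hrank hrad hT hTB hκ₀ hκ₁ (lt_of_le_of_lt (by gcongr) hd)
  refine ⟨B', hreg, hsub, hrank', hrad', fun t ht => ?_⟩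
  obtain ⟨t₀, ht₀⟩ := hT
  have hsmooth := eLpNorm_shift_sub_le_of_abs_le (q := 2 * m) (by linarith)
    (fun x => abs_iterate_smooth_shift_sub_le A L T hkκ t₀ (hspec t ht) x) ν
  rw [← hg] at hsmooth
  have hp : 1 ≤ ENNReal.ofReal (2 * m) := ENNReal.one_le_ofReal.2 (by linarith)
  exact (eLpNorm_shift_sub_le_of_smooth (zero_mem_bohr _ B.radius_nonneg)
    (fun _ => neg_mem_bohr) hinv hp hTB hh ht₀ hkr (hsub.carrier_subset ht) hsmooth).trans
      (add_le_add_left (four_mul_two_mul_ofReal_le hε hm hk _ _) _)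

end Main

theorem mainTheorem6 :
    ∃ C₁ C₂ : ℝ, 0 < C₁ ∧ 0 < C₂ ∧
      ∀ (G : Type*) [AddCommGroup G] [Fintype G] [DecidableEq G]
        [MeasurableSpace G] [DiscreteMeasurableSpace G]
        (m ε δ K η : ℝ) (A L S : Finset G) (B : BohrSet G) (r : ℕ)
        (ν μ : MeasureTheory.Measure G) (g f : G → ℝ),
        1 ≤ m → 0 < ε → ε < 1 → 0 < δ → δ < 1 →
        A.Nonempty → L.Nonempty → S.Nonempty →
        η = (A.card : ℝ) / (L.card : ℝ) → η ≤ 1 →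
        B.IsRegular → 1 ≤ B.rank → B.radius ≤ 2 →
        C₁ * Real.log (2 / (δ * η)) ≤ (r : ℝ) →
        IsInvariantPair (iteratedSumset r B.carrier) ν μ →
        (S : Set G) ⊆ B.carrier →
        ((A + S).card : ℝ) ≤ K * (A.card : ℝ) →
        g = conv (unif A) (ind L) →
        f = (fun x => g x * (1 - g x)) →
        ∃ (B' : BohrSet G) (d' : ℕ),
          0 < d' ∧
          (d' : ℝ) ≤ C₂ * (m * (ε ^ 2)⁻¹ * Real.log (2 / (δ * η)) ^ 2 * Real.log (2 * K)
            + Real.log (1 / ((S.card : ℝ) / (B.carrier.ncard : ℝ)))) ∧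
          B'.IsRegular ∧ B'.IsSub B ∧
          B'.rank ≤ B.rank + d' ∧
          B.radius * δ * Real.sqrt η / ((B.rank : ℝ) ^ 2 * (d' : ℝ)) ≤ B'.radius ∧
          ∀ t ∈ B'.carrier,
            MeasureTheory.eLpNorm (fun x => g (x + t) - g x) (ENNReal.ofReal (2 * m)) ν ≤
              ENNReal.ofReal ε *
                  MeasureTheory.eLpNorm f (ENNReal.ofReal m) μ ^ (1 / 2 : ℝ)
                + ENNReal.ofReal (ε ^ (2 - 1 / m)) *
                  MeasureTheory.eLpNorm f 1 μ ^ (1 / (2 * m))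
                + ENNReal.ofReal δ * ν Set.univ ^ (1 / (2 * m)) := by
  -- `19327352832 = 4718592 * 4096` combines the losses in `chang_bohr` and `exists_regular_dilate`.
  refine ⟨10, 19327352832 * 10 ^ 6, by norm_num, by norm_num, ?_⟩
  intro G _ _ _ _ _ m ε δ K η A L S B r ν μ g f hm hε₀ hε₁ hδ₀ hδ₁ hA hL hS hη hη₁ hB hrank hrad
    hr hinv hSB hAS hg hf
  have hη₀ : 0 < η := hη ▸ div_pos (Nat.cast_pos.2 hA.card_pos) (Nat.cast_pos.2 hL.card_pos)
  obtain ⟨k, n, d, hk, hlk, hkl, hn, hd_pos, hd, hd_le⟩ :=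
    exists_parameters hm hε₀ hε₁ (half_le_log_two_div hδ₀ hδ₁.le hη₀ hη₁)
      (one_le_of_card_add_le hA hS hAS) (one_le_ncard_div_card hS hSB)
  have hkr : 1 + 2 * k ≤ r := by exact_mod_cast hkl.trans hr
  have hκ₁ : δ * √η ≤ 1 := mul_le_one₀ hδ₁.le (Real.sqrt_nonneg _) (Real.sqrt_le_one.2 hη₁)
  have hκ : √(L.card / A.card) * (δ * √η) = δ := by
    rw [← inv_div, ← hη, Real.sqrt_inv, mul_left_comm,
      inv_mul_cancel₀ (Real.sqrt_pos.2 hη₀).ne', mul_one]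
  obtain ⟨B', hreg, hsub, hrank', hrad', hB'⟩ := exists_bohr_almost_periods hA hS L hB hrank hrad
    hSB hm hε₀ hκ₁ hAS hk hkr (half_pow_mul_two_le hδ₀ hη₀ hη₁ hlk) hn hd hinv hg hf
  refine ⟨B', 19327352832 * d, by omega, ?_, hreg, hsub, by omega, ?_, hκ ▸ hB'⟩
  · rw [one_div_div, Nat.cast_mul, mul_assoc (19327352832 : ℝ)]
    exact mul_le_mul_of_nonneg_left hd_le (by norm_num)
  · refine le_of_eq_of_le ?_ hrad'
    push_cast
    ring
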